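/- **Setting.** Let $(\Sigma,d)$ be a finite metric space with $1\le d(x,y)\le B$ for all $x\ne y$. For $D>0$, a probability distribution $\mathcal H_D$ on hash functions on $\Sigma$ is a *$C$-probabilistically separating hashing* at scale $D$ if (1) $d(x,y)\ge D$ implies $\pi(x)\neq\pi(y)$ for every $\pi$ in the support of $\mathcal H_D$, and (2) $\Pr_{\pi\sim\mathcal H_D}(\pi(x)\ne\pi(y))\le C\,d(x,y)/D$ for all $x,y\in\Sigma$. Let such an $\mathcal H_D$ be given for every $D=2^k$ with $k\ge 0$ an integer and $2^k\le B$ (also for $D=1$). Let $T=t_0\dots t_{n-1}$ be a text and $P=p_0\dots p_{m-1}$ a pattern over $\Sigma$, and $S(i)=\sum_{j=0}^{m-1}d(p_j,t_{i+j})$ for an offset $i\ge0$ with $i+m\le n$. **One call of the sampling procedure** (scale $D$, rate $q$): draw $\pi\sim\mathcal H_D$ and, independently, replace every position of the pattern by a "don't care" with probability $1-q$, independently over the positions. With hash values encoded as natural numbers, compute for every offset $i$, over the kept positions $j$ only, $A_0=\sum_j(\pi(p_j)-\pi(t_{i+j}))^2$ and $A_1=\sum_j j\,(\pi(p_j)-\pi(t_{i+j}))^2$.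 The answer at $i$ is "match" if $A_0=0$; otherwise it is the position $r=\lfloor A_1/A_0\rfloor$, if $r$ is a kept position with $(\pi(p_r)-\pi(t_{i+r}))^2=A_0$, and $\bot$ if not. (So: "match" if no kept position is a mismatch, the position of the mismatch if there is exactly one, and $\bot$ if there are several.) **The algorithm** (with $K$ repetitions). For every scale $D=2^k\le B$ and every rate $q=2^{-1},2^{-2},\dots$ with $q>1/m$, make $K$ calls, all calls being independent. For an offset $i$ and a scale $D$, let $m_0(q)$ be the number of answers "match" at $i$ at rate $q$, and let $M_1(q)$ be the multiset of answered positions $j$ with $D\le d(t_{i+j},p_j)<2D$. Among the rates with $m_0(q)\ge e^{-4}K$ choose one that maximises $q\,m_0(q)$ (ties are broken by any fixed rule that looks only at the numbers $m_0(\cdot)$), and put $S_D(i)=\frac{1-q}{q\,m_0(q)}\sum_{j\in M_1(q)}d(t_{i+j},p_j)$; put $S_D(i)=0$ if there is no such rate. The output is $R(i)=\sum_D S_D(i)$. **Theorem.** There is a universal constant $a>0$ such that the following holds whenever $0<\varepsilon\le1$, $t\ge1$, $m\ge3$, $K\ge a\,C\,t/\varepsilon^2$, and $\log|\Sigma|\le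 e^{Ct}$ (which is automatic if $C\ge\log|\Sigma|$). For every offset $i$ with $S(i)\neq0$, $$\Pr\bigl(|R(i)-S(i)|\ge\varepsilon R(i)\bigr)\le e^{-t},$$ and for every offset $i$ with $S(i)=0$ the output is always $R(i)=0$. -/

import Mathlib

open MeasureTheory

namespace PatternDistance

noncomputable section

/-- `H`, a probability distribution on hash functions of the alphabet `A`, is a
`C`-probabilistically separating hashing at scale `D`. Hash values are natural numbers, since on a
finite alphabet only equality of hash values matters. -/
def IsProbSeparating {A : Type*} [Fintype A] [MetricSpace A] (C D : ℝ) (H : PMF (A → ℕ)) : Prop :=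
  (∀ x y : A, D ≤ dist x y → ∀ π ∈ H.support, π x ≠ π y) ∧
    ∀ x y : A, H.toMeasure.real {π | π x ≠ π y} ≤ C * (dist x y / D)

/-- The possible answers of the one-mismatch procedure at an offset. -/
inductive Label (m : ℕ) where
  /-- there is no mismatch -/
  | isMatch : Label m
  /-- there is exactly one mismatch, at this position of the pattern -/
  | mismatchAt (j : Fin m) : Label m
  /-- there is more than one mismatch -/
  | bot : Label m

/-- `(a - b)²` -/
def sqDiff (a b : ℕ) : ℕ := ((a : ℤ) - (b : ℤ)).natAbs ^ 2

/-- `A₀ = ∑ⱼ p'ⱼ (pⱼ - tⱼ)²`, where `p'ⱼ` is `0` if position `j` of the pattern is a "don't care"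
(`keep j = false`) and `1` otherwise; `t` is the window of the text at the offset. -/
def mismatchSum {m : ℕ} (keep : Fin m → Bool) (p t : Fin m → ℕ) : ℕ :=
  ∑ j, if keep j then sqDiff (p j) (t j) else 0

/-- `A₁ = ∑ⱼ j p'ⱼ (pⱼ - tⱼ)²` -/
def mismatchMoment {m : ℕ} (keep : Fin m → Bool) (p t : Fin m → ℕ) : ℕ :=
  ∑ j : Fin m, if keep j then (j : ℕ) * sqDiff (p j) (t j) else 0

/-- The one-mismatch procedure at one offset: the label is "match" if `A₀ = 0`; otherwise the
position `r = A₁ / A₀` is proposed, and it is verified that `r` is a position of the pattern, is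
not a "don't care", and that `(p_r - t_r)² = A₀`. -/
def oneMismatch {m : ℕ} (keep : Fin m → Bool) (p t : Fin m → ℕ) : Label m :=
  if mismatchSum keep p t = 0 then .isMatch
  else if h : mismatchMoment keep p t / mismatchSum keep p t < m then
    if keep ⟨_, h⟩ = true ∧ sqDiff (p ⟨_, h⟩) (t ⟨_, h⟩) = mismatchSum keep p t then
      .mismatchAt ⟨_, h⟩
    else .bot
  else .bot

/-- The window `t_i … t_{i+m-1}` of a text of length `n`. -/
def window {A : Type*} {m n : ℕ} (T : Fin n → A) (i : ℕ) (hi : i + m ≤ n) (j : Fin m) : A :=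
  T ⟨i + j, by omega⟩

/-- The exact distance `∑ⱼ d(pⱼ, t_{i+j})`. -/
def exactDist {A : Type*} [MetricSpace A] {m n : ℕ} (T : Fin n → A) (P : Fin m → A) (i : ℕ)
    (hi : i + m ≤ n) : ℝ :=
  ∑ j, dist (P j) (window T i hi j)

/-- Indices of the scales `D = 2 ^ k`, `1 ≤ D ≤ B`. -/
abbrev ScaleIdx (B : ℝ) : Type := Fin (Nat.log 2 ⌊B⌋₊ + 1)

/-- Indices of the sampling rates `q = 2 ^ (-(l+1))`, `1/m < q ≤ 1/2`. -/
abbrev RateIdx (m : ℕ) : Type := {l : Fin m // 2 ^ ((l : ℕ) + 1) < m}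

/-- The scale `D = 2 ^ k`. -/
def scale {B : ℝ} (k : ScaleIdx B) : ℝ := 2 ^ (k : ℕ)

/-- The sampling rate `q = 2 ^ (-(l+1))`. -/
def rate {m : ℕ} (l : RateIdx m) : ℝ := (1 / 2) ^ ((l : ℕ) + 1)

theorem rate_mem {m : ℕ} (l : RateIdx m) : rate l ∈ unitInterval :=
  ⟨by unfold rate; positivity, pow_le_one₀ (by norm_num) (by norm_num)⟩

/-- The randomness of one call of the sampling procedure: a hash function, and the set of pattern
positions that are kept (the others become "don't care"). -/
abbrev Seed (A : Type*) (m : ℕ) : Type _ := (A → ℕ) × (Fin m → Bool)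

/-- The law of one call at rate `q`: a hash function drawn from `H` and, independently, every
position kept with probability `q`, independently of the others. -/
def seedLaw {A : Type*} [Fintype A] {m : ℕ} (H : PMF (A → ℕ)) (l : RateIdx m) :
    Measure (Seed A m) :=
  H.toMeasure.prod (Measure.pi fun _ : Fin m =>
    ProbabilityTheory.bernoulliMeasure true false ⟨rate l, rate_mem l⟩)

/-- The randomness of a whole run: one seed for every scale, rate and iteration. -/
abbrev Run (A : Type*) (m : ℕ) (B : ℝ) (K : ℕ) : Type _ :=
  ScaleIdx B × RateIdx m × Fin K → Seed A m

/-- The law of a whole run: all calls are independent. -/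
def runLaw {A : Type*} [Fintype A] (m : ℕ) (B : ℝ) (K : ℕ) (H : ScaleIdx B → PMF (A → ℕ)) :
    Measure (Run A m B K) :=
  Measure.pi fun c => seedLaw (H c.1) c.2.1

/-- The label that a call of the sampling procedure on the hashed pattern `p` and the hashed text
window `t` returns. -/
def sampleLabel {A : Type*} {m : ℕ} (s : Seed A m) (p t : Fin m → A) : Label m :=
  oneMismatch s.2 (fun j => s.1 (p j)) (fun j => s.1 (t j))

/-- `1` for the label "match" and `0` otherwise. -/
def Label.matchCount {m : ℕ} : Label m → ℕ
  | .isMatch => 1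
  | .mismatchAt _ => 0
  | .bot => 0

/-- `d(t_j, p_j)` if the label is a mismatch at `j` with `D ≤ d(t_j, p_j) < 2 D`, otherwise `0`. -/
def Label.distAt {A : Type*} [MetricSpace A] {m : ℕ} (D : ℝ) (p t : Fin m → A) : Label m → ℝ
  | .isMatch => 0
  | .mismatchAt j =>
      if D ≤ dist (t j) (p j) ∧ dist (t j) (p j) < 2 * D then dist (t j) (p j) else 0
  | .bot => 0

/-- `m₀`: the number of matches among the `K` calls at scale `k` and rate `l`. -/
def numMatches {A : Type*} {m : ℕ} {B : ℝ} {K : ℕ} (ω : Run A m B K) (p t : Fin m → A)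
    (k : ScaleIdx B) (l : RateIdx m) : ℕ :=
  ∑ r : Fin K, (sampleLabel (ω (k, l, r)) p t).matchCount

/-- `∑_{j ∈ M₁} d(t_j, p_j)`, with repetitions, over the mismatches with distance in `[D, 2 D)`
that the `K` calls at scale `k` and rate `l` returned. -/
def distSum {A : Type*} [MetricSpace A] {m : ℕ} {B : ℝ} {K : ℕ} (ω : Run A m B K)
    (p t : Fin m → A) (k : ScaleIdx B) (l : RateIdx m) : ℝ :=
  ∑ r : Fin K, (sampleLabel (ω (k, l, r)) p t).distAt (scale k) p t

/-- `sel` is a rule for choosing the rate from the numbers of matches `c l`: among the rates with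
`c l ≥ e⁻⁴ K` it returns one that maximises `q · c l` (ties are broken in any way), and it returns
`none` only if there is no such rate. -/
def IsRateRule {m : ℕ} (K : ℕ) (sel : (RateIdx m → ℕ) → Option (RateIdx m)) : Prop :=
  ∀ c : RateIdx m → ℕ,
    (∀ l, sel c = some l → Real.exp (-4) * K ≤ c l ∧
      ∀ l', Real.exp (-4) * K ≤ c l' → rate l' * c l' ≤ rate l * c l) ∧
    (sel c = none → ∀ l, ¬ Real.exp (-4) * K ≤ c l)

/-- `S_D`, the estimate at one scale; it is `0` if there is no rate to choose. -/
def scaleEstimate {A : Type*} [MetricSpace A] {m : ℕ} {B : ℝ} {K : ℕ}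
    (sel : (RateIdx m → ℕ) → Option (RateIdx m)) (ω : Run A m B K) (p t : Fin m → A)
    (k : ScaleIdx B) : ℝ :=
  match sel (numMatches ω p t k) with
  | none => 0
  | some l => (1 - rate l) / (rate l * numMatches ω p t k l) * distSum ω p t k l

/-- The output `R(i) = ∑_D S_D(i)` of the algorithm. -/
def output {A : Type*} [MetricSpace A] {m n : ℕ} {B : ℝ} {K : ℕ}
    (sel : (RateIdx m → ℕ) → Option (RateIdx m)) (ω : Run A m B K) (T : Fin n → A)
    (P : Fin m → A) (i : ℕ) (hi : i + m ≤ n) : ℝ :=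
  ∑ k : ScaleIdx B, scaleEstimate sel ω P (window T i hi) k

end

end PatternDistance

namespace PatternDistance

noncomputable section

/-! Fix an offset and a scale `D`, and let `w` be the part of the distance `S` that comes from
positions with distance in `[D, 2D)`. Every hash function in the support separates such a position.
If a hash produces `X` mismatches, a call answers "match" with probability `(1-q)^X` and isolates a
given mismatch with probability `q(1-q)^(X-1)`. The ratio `q/(1-q)` does not involve `X`, so it
survives averaging over hashes (`labelProb_mismatchAt`). Hence the estimate at any fixed rate is a
ratio estimator of `w`. What remains is concentration at a rate that is itself chosen from the data;
this is done for the abstract `CallModel`, where "match" is a hit.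

Let `n` be the number of positions of the scale, `p` the hit probability and `x = C S / D`, a bound
on the mean number of hash mismatches. A rate is medium if `1 - p ≥ 1/48` and `n q < 256`.
Conditionally on all hit indicators the selected rates are fixed and the values are still
independent, so an exponential moment (`expect_exp_centred_le_one`, `prob_centred_le`) controls the
fluctuations of all scales together. One exponent serves every scale because `D x = C S` does not
depend on the scale. The conditional mean differs from `w` by a relative error of order `|m₀ - pK| /
K` (`abs_condEst_sub_le`), which is treated by Chernoff bounds.

A rate that is too small loses against the doubled rate (`expect_selected_high_le`), and one that is
too large does not reach the threshold `e⁻⁴ K` (`expect_selected_low_le`). Such events are charged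
in expectation, with the size of the estimate included, so that Markov's inequality applies to the
sum over the scales.

A union bound would cost factors `log m` and `log B`. Instead the bound for a rate carries
`rateWeight`, whose sum over the rates telescopes to `2 log (4x/n)`, and `x/n ≤ 2 C S / w`.
Averaging `log (S/w)` with weights `w/S` gives an entropy, at most the logarithm of the number of
contributing scales, hence at most `2 log |Σ|`. So the total cost is `O(exp (C t))`, and this is
absorbed by the exponential decay in `K ε²`. -/

/-! ### Correctness of the one-mismatch test. -/

theorem sqDiff_eq_zero_iff (a b : ℕ) : sqDiff a b = 0 ↔ a = b := by
  simp [sqDiff, sub_eq_zero]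

theorem mismatchSum_eq_zero_iff {m : ℕ} (keep : Fin m → Bool) (p t : Fin m → ℕ) :
    mismatchSum keep p t = 0 ↔ ∀ j, keep j = true → p j = t j := by
  simp [mismatchSum, Finset.sum_eq_zero_iff, sqDiff_eq_zero_iff]

theorem oneMismatch_eq_isMatch_iff {m : ℕ} (keep : Fin m → Bool) (p t : Fin m → ℕ) :
    oneMismatch keep p t = .isMatch ↔ ∀ j, keep j = true → p j = t j := by
  rw [← mismatchSum_eq_zero_iff]
  unfold oneMismatch
  split_ifs <;> simp_all

theorem mismatchSum_eq_of_unique {m : ℕ} {keep : Fin m → Bool} {p t : Fin m → ℕ} {j : Fin m}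
    (hj : keep j = true) (h : ∀ i, i ≠ j → keep i = true → p i = t i) :
    mismatchSum keep p t = sqDiff (p j) (t j) := by
  unfold mismatchSum
  rw [Finset.sum_eq_single j]
  · simp [hj]
  · intro i _ hij
    by_cases hk : keep i = true
    · simp [hk, (sqDiff_eq_zero_iff _ _).2 (h i hij hk)]
    · simp [hk]
  · simp

theorem mismatchMoment_eq_of_unique {m : ℕ} {keep : Fin m → Bool} {p t : Fin m → ℕ} {j : Fin m}
    (hj : keep j = true) (h : ∀ i, i ≠ j → keep i = true → p i = t i) :
    mismatchMoment keep p t = j * sqDiff (p j) (t j) := by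
  unfold mismatchMoment
  rw [Finset.sum_eq_single j]
  · simp [hj]
  · intro i _ hij
    by_cases hk : keep i = true
    · simp [hk, (sqDiff_eq_zero_iff _ _).2 (h i hij hk)]
    · simp [hk]
  · simp

/-- The verification makes the answer sound however `r` was proposed: `A₀` is a sum of nonnegative
terms, so equality with its term at `r` kills all others. Completeness holds because a unique
mismatch at `j` gives `A₁ = j A₀`. -/
theorem oneMismatch_eq_mismatchAt_iff {m : ℕ} (keep : Fin m → Bool) (p t : Fin m → ℕ)
    (j : Fin m) :
    oneMismatch keep p t = .mismatchAt j ↔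
      keep j = true ∧ p j ≠ t j ∧ ∀ i, i ≠ j → keep i = true → p i = t i := by
  constructor
  · intro h
    unfold oneMismatch at h
    split_ifs at h with h0 h1 h2
    obtain rfl := Label.mismatchAt.inj h
    obtain ⟨hk, hs⟩ := h2
    refine ⟨hk, fun he => h0 (hs ▸ (sqDiff_eq_zero_iff _ _).2 he), fun i hij hi => ?_⟩
    set r : Fin m := ⟨_, h1⟩ with hr
    unfold mismatchSum at hs
    rw [← Finset.add_sum_erase _ _ (Finset.mem_univ r), if_pos hk, left_eq_add,
      Finset.sum_eq_zero_iff] at hs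
    have := hs i (by simp [hij])
    simpa [hi, sqDiff_eq_zero_iff] using this
  · rintro ⟨hj, hne, h⟩
    have h0 : sqDiff (p j) (t j) ≠ 0 := fun h => hne ((sqDiff_eq_zero_iff _ _).1 h)
    have hd : mismatchMoment keep p t / mismatchSum keep p t = j := by
      rw [mismatchSum_eq_of_unique hj h, mismatchMoment_eq_of_unique hj h,
        Nat.mul_div_cancel _ (Nat.pos_of_ne_zero h0)]
    unfold oneMismatch
    simp only [hd, Fin.is_lt, dite_true, Fin.eta, hj, true_and]
    simp [mismatchSum_eq_of_unique hj h, h0]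

/-- The pattern positions at which the hash values of the pattern and of the text differ. -/
def hashMismatches {A : Type*} {m : ℕ} (p t : Fin m → A) (π : A → ℕ) : Finset (Fin m) :=
  {j | π (p j) ≠ π (t j)}

theorem mem_hashMismatches {A : Type*} {m : ℕ} {p t : Fin m → A} {π : A → ℕ} {j : Fin m} :
    j ∈ hashMismatches p t π ↔ π (p j) ≠ π (t j) := by
  simp [hashMismatches]

theorem sampleLabel_eq_isMatch_iff {A : Type*} {m : ℕ} (s : Seed A m) (p t : Fin m → A) :
    sampleLabel s p t = .isMatch ↔ ∀ j ∈ hashMismatches p t s.1, s.2 j = false := by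
  simp only [sampleLabel, oneMismatch_eq_isMatch_iff, mem_hashMismatches]
  refine forall_congr' fun j => ?_
  cases s.2 j <;> simp

theorem sampleLabel_eq_mismatchAt_iff {A : Type*} {m : ℕ} (s : Seed A m) (p t : Fin m → A)
    (j : Fin m) :
    sampleLabel s p t = .mismatchAt j ↔ j ∈ hashMismatches p t s.1 ∧ s.2 j = true ∧
      ∀ i ∈ (hashMismatches p t s.1).erase j, s.2 i = false := by
  simp only [sampleLabel, oneMismatch_eq_mismatchAt_iff, mem_hashMismatches, Finset.mem_erase]
  rw [and_left_comm]
  refine and_congr_right fun _ => and_congr_right fun _ => forall_congr' fun i => ?_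
  cases s.2 i <;> simp +contextual

/-! ### The law of the answer of one call. -/

/-- The law of the set of kept positions at rate `q`. -/
abbrev keepLaw {m : ℕ} (l : RateIdx m) : Measure (Fin m → Bool) :=
  Measure.pi fun _ : Fin m =>
    ProbabilityTheory.bernoulliMeasure true false ⟨rate l, rate_mem l⟩

theorem bernoulli_real_false {m : ℕ} (l : RateIdx m) :
    (ProbabilityTheory.bernoulliMeasure true false ⟨rate l, rate_mem l⟩).real {false} =
      1 - rate l := by
  rw [ProbabilityTheory.bernoulliMeasure_real_apply] <;> simp

theorem bernoulli_real_true {m : ℕ} (l : RateIdx m) :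
    (ProbabilityTheory.bernoulliMeasure true false ⟨rate l, rate_mem l⟩).real {true} =
      rate l := by
  rw [ProbabilityTheory.bernoulliMeasure_real_apply] <;> simp

theorem keepLaw_real_forall {m : ℕ} (l : RateIdx m) (X : Finset (Fin m)) :
    (keepLaw l).real {keep | ∀ j ∈ X, keep j = false} = (1 - rate l) ^ X.card := by
  classical
  have h : {keep : Fin m → Bool | ∀ j ∈ X, keep j = false} =
      Set.univ.pi fun j => if j ∈ X then {false} else Set.univ := by
    ext keep
    simp only [Set.mem_ofPred_eq, Set.mem_univ_pi]
    refine forall_congr' fun j => ?_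
    split_ifs with hj <;> simp [hj]
  rw [h, measureReal_def, Measure.pi_pi, ENNReal.toReal_prod,
    ← Finset.prod_const, ← Finset.prod_subset (Finset.subset_univ X)]
  · refine Finset.prod_congr rfl fun j hj => ?_
    rw [if_pos hj, ← measureReal_def, bernoulli_real_false]
  · intro j _ hj
    simp [hj]

/-- The factor `1 - rate l` on the left completes the exponent `X.card - 1` to `X.card`, which makes
the right side comparable with `keepLaw_real_forall`. -/
theorem keepLaw_real_single {m : ℕ} (l : RateIdx m) (X : Finset (Fin m)) {j : Fin m}
    (hj : j ∈ X) :
    (1 - rate l) * (keepLaw l).real {keep | keep j = true ∧ ∀ i ∈ X.erase j, keep i = false} =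
      rate l * (1 - rate l) ^ X.card := by
  classical
  have h : {keep : Fin m → Bool | keep j = true ∧ ∀ i ∈ X.erase j, keep i = false} =
      Set.univ.pi fun i => if i = j then {true} else if i ∈ X then {false} else Set.univ := by
    ext keep
    simp only [Set.mem_ofPred_eq, Set.mem_univ_pi]
    constructor
    · rintro ⟨h1, h2⟩ i
      split_ifs with hij hi
      · simp [hij, h1]
      · simpa using h2 i (by simp [hij, hi])
      · simp
    · intro h
      refine ⟨by simpa using h j, fun i hi => ?_⟩
      rw [Finset.mem_erase] at hi
      simpa [hi.1, hi.2] using h i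
  have h2 : ∏ i, ((ProbabilityTheory.bernoulliMeasure true false ⟨rate l, rate_mem l⟩)
      (if i = j then {true} else if i ∈ X then {false} else Set.univ)).toReal =
      ∏ i ∈ X, if i = j then rate l else 1 - rate l := by
    rw [← Finset.prod_subset (Finset.subset_univ X)]
    · refine Finset.prod_congr rfl fun i hi => ?_
      split_ifs with hij
      · rw [← measureReal_def, bernoulli_real_true]
      · rw [← measureReal_def, bernoulli_real_false]
    · intro i _ hi
      have : i ≠ j := fun h => hi (h ▸ hj)
      simp [hi, this]
  rw [h, measureReal_def, Measure.pi_pi, ENNReal.toReal_prod, h2,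
    ← Finset.mul_prod_erase _ _ hj, if_pos rfl]
  have h3 : ∏ i ∈ X.erase j, (if i = j then rate l else 1 - rate l) =
      (1 - rate l) ^ (X.erase j).card := by
    rw [← Finset.prod_const]
    refine Finset.prod_congr rfl fun i hi => if_neg (Finset.ne_of_mem_erase hi)
  rw [h3, Finset.card_erase_of_mem hj]
  obtain ⟨c, hc⟩ : ∃ c, X.card = c + 1 := ⟨X.card - 1, by
    have := Finset.card_pos.2 ⟨j, hj⟩
    omega⟩
  rw [hc]
  simp
  ring

instance {A : Type*} [Fintype A] {m : ℕ} (H : PMF (A → ℕ)) (l : RateIdx m) :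
    IsProbabilityMeasure (seedLaw H l) := by
  unfold seedLaw
  infer_instance

/-- The probability of a label in one call of the sampling procedure. -/
def labelProb {A : Type*} [Fintype A] {m : ℕ} (H : PMF (A → ℕ)) (l : RateIdx m)
    (p t : Fin m → A) (L : Label m) : ℝ :=
  (seedLaw H l).real {s | sampleLabel s p t = L}

theorem prod_real_eq_integral {X Y : Type*} [MeasurableSpace X] [MeasurableSpace Y]
    (μ : Measure X) (ν : Measure Y) [IsProbabilityMeasure μ] [IsProbabilityMeasure ν]
    {s : Set (X × Y)} (hs : MeasurableSet s) :
    (μ.prod ν).real s = ∫ x, ν.real (Prod.mk x ⁻¹' s) ∂μ := by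
  rw [measureReal_def, Measure.prod_apply hs]
  simp only [measureReal_def]
  rw [integral_toReal]
  · exact (measurable_measure_prodMk_left hs).aemeasurable
  · exact Filter.Eventually.of_forall fun x => measure_lt_top _ _

theorem labelProb_isMatch {A : Type*} [Fintype A] {m : ℕ} (H : PMF (A → ℕ)) (l : RateIdx m)
    (p t : Fin m → A) :
    labelProb H l p t .isMatch =
      ∫ π, (1 - rate l) ^ (hashMismatches p t π).card ∂H.toMeasure := by
  unfold labelProb seedLaw
  rw [prod_real_eq_integral _ _ (MeasurableSet.of_discrete)]
  congr 1
  ext π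
  rw [← keepLaw_real_forall]
  congr 1
  ext keep
  simp [sampleLabel_eq_isMatch_iff]

theorem ae_mem_support {X : Type*} [MeasurableSpace X] [DiscreteMeasurableSpace X] (H : PMF X) :
    ∀ᵐ x ∂H.toMeasure, x ∈ H.support := by
  rw [ae_iff, PMF.toMeasure_apply_eq_zero_iff _ MeasurableSet.of_discrete]
  rw [Set.disjoint_left]
  intro x hx hx'
  exact hx' hx

/-- The source of unbiasedness. For a fixed hash the odds of isolating `j` against seeing no
mismatch are `q : (1-q)`, whatever the number of mismatches; as `j` is a mismatch for almost every
hash, the identity can be integrated. -/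
theorem labelProb_mismatchAt {A : Type*} [Fintype A] {m : ℕ} (H : PMF (A → ℕ)) (l : RateIdx m)
    (p t : Fin m → A) (j : Fin m) (hj : ∀ π ∈ H.support, π (p j) ≠ π (t j)) :
    (1 - rate l) * labelProb H l p t (.mismatchAt j) = rate l * labelProb H l p t .isMatch := by
  rw [labelProb_isMatch]
  unfold labelProb seedLaw
  rw [prod_real_eq_integral _ _ (MeasurableSet.of_discrete), ← integral_const_mul,
    ← integral_const_mul]
  refine integral_congr_ae ?_
  filter_upwards [ae_mem_support H] with π hπ
  have hm : j ∈ hashMismatches p t π := mem_hashMismatches.2 (hj π hπ)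
  rw [← keepLaw_real_single l _ hm]
  congr 2
  ext keep
  simp [sampleLabel_eq_mismatchAt_iff, hm]

section LabelLaw

variable {A : Type*} [Fintype A] {m : ℕ} (H : PMF (A → ℕ)) (l : RateIdx m) (p t : Fin m → A)

theorem rate_pos : 0 < rate l := by
  unfold rate
  positivity

theorem rate_le_half : rate l ≤ 1 / 2 := by
  unfold rate
  rw [pow_succ]
  have : (1 / 2 : ℝ) ^ (l : ℕ) ≤ 1 := pow_le_one₀ (by norm_num) (by norm_num)
  linarith

theorem integrable_of_mem_Icc {X : Type*} [MeasurableSpace X] [DiscreteMeasurableSpace X]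
    [Countable X] (μ : Measure X) [IsFiniteMeasure μ] {f : X → ℝ} {c : ℝ}
    (h : ∀ x, |f x| ≤ c) : Integrable f μ :=
  Integrable.of_bound (Measurable.of_discrete.aestronglyMeasurable) c
    (Filter.Eventually.of_forall h)

theorem integrable_pow_hashMismatches :
    Integrable (fun π => (1 - rate l) ^ (hashMismatches p t π).card) H.toMeasure := by
  have h1 := rate_le_half l
  have h2 := rate_pos l
  refine integrable_of_mem_Icc _ (c := 1) fun π => ?_
  rw [abs_of_nonneg (pow_nonneg (by linarith) _)]
  exact pow_le_one₀ (by linarith) (by linarith)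

theorem labelProb_nonneg (L : Label m) : 0 ≤ labelProb H l p t L := measureReal_nonneg

theorem integrable_card_hashMismatches :
    Integrable (fun π => ((hashMismatches p t π).card : ℝ)) H.toMeasure := by
  refine integrable_of_mem_Icc _ (c := m) fun π => ?_
  rw [abs_of_nonneg (by positivity)]
  exact_mod_cast (Finset.card_le_univ _).trans (by simp)

theorem integral_card_hashMismatches :
    ∫ π, ((hashMismatches p t π).card : ℝ) ∂H.toMeasure =
      ∑ j, H.toMeasure.real {π | π (p j) ≠ π (t j)} := by
  have h : ∀ π : A → ℕ, ((hashMismatches p t π).card : ℝ) =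
      ∑ j, ({π : A → ℕ | π (p j) ≠ π (t j)}.indicator (fun _ => (1 : ℝ)) π) := by
    intro π
    simp [hashMismatches, Finset.card_filter, Set.indicator_apply]
  simp only [h]
  rw [integral_finsetSum]
  · refine Finset.sum_congr rfl fun j _ => ?_
    rw [integral_indicator_const _ MeasurableSet.of_discrete]
    simp
  · intro j _
    exact (integrable_const _).indicator MeasurableSet.of_discrete

/-- Bernoulli's inequality `(1-q)^X ≥ 1 - qX`, and the second separation property summed over the
positions to bound the mean of `X`. -/
theorem one_sub_labelProb_isMatch_le [MetricSpace A] {C D : ℝ} (hH : IsProbSeparating C D H) :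
    1 - labelProb H l p t .isMatch ≤ rate l * (C * (∑ j, dist (p j) (t j)) / D) := by
  have h1 := rate_le_half l
  have h2 := rate_pos l
  have h3 : ∫ π, ((hashMismatches p t π).card : ℝ) ∂H.toMeasure ≤
      C * (∑ j, dist (p j) (t j)) / D := by
    rw [integral_card_hashMismatches, Finset.mul_sum, Finset.sum_div]
    refine Finset.sum_le_sum fun j _ => (hH.2 _ _).trans_eq (by ring)
  have h4 : ∫ π, (1 - rate l * ((hashMismatches p t π).card : ℝ)) ∂H.toMeasure ≤
      labelProb H l p t .isMatch := by
    rw [labelProb_isMatch]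
    refine integral_mono ((integrable_const _).sub
      ((integrable_card_hashMismatches H p t).const_mul _))
      (integrable_pow_hashMismatches H l p t) fun π => ?_
    have := one_add_mul_le_pow (a := -rate l) (by linarith) (hashMismatches p t π).card
    calc _ = 1 + ((hashMismatches p t π).card : ℝ) * -rate l := by ring
      _ ≤ _ := this
      _ = _ := by ring
  rw [integral_sub (integrable_const _) ((integrable_card_hashMismatches H p t).const_mul _),
    integral_const_mul] at h4
  simp only [integral_const, probReal_univ, smul_eq_mul, mul_one] at h4
  nlinarith [mul_le_mul_of_nonneg_left h3 h2.le]

/-- Since `2q ≤ 1/2`, one has `(1-q)^3 ≤ 1-2q`; with `u = (1-q)^X` this gives `(1-2q)^X ≥ u^3 ≥ 3u -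
2`, the last step being `(u-1)^2 (u+2) ≥ 0`. The bound is affine in `u`, so it passes to the mean
over hashes. -/
theorem one_sub_labelProb_isMatch_le_of_rate_double {l l' : RateIdx m}
    (hl : rate l' = 2 * rate l) :
    1 - labelProb H l' p t .isMatch ≤ 3 * (1 - labelProb H l p t .isMatch) := by
  have h1 := rate_le_half l'
  have h2 := rate_pos l
  have h : ∫ π, (3 * (1 - rate l) ^ (hashMismatches p t π).card - 2) ∂H.toMeasure ≤
      labelProb H l' p t .isMatch := by
    rw [labelProb_isMatch]
    refine integral_mono (((integrable_pow_hashMismatches H l p t).const_mul _).sub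
      (integrable_const _)) (integrable_pow_hashMismatches H l' p t) fun π => ?_
    set c := (hashMismatches p t π).card
    have h3 : (1 - rate l) ^ 3 ≤ 1 - rate l' := by
      rw [hl] at h1 ⊢
      nlinarith [mul_nonneg h2.le (sq_nonneg (rate l))]
    have h4 : ((1 - rate l) ^ c) ^ 3 ≤ (1 - rate l') ^ c := by
      rw [← pow_mul, mul_comm, pow_mul]
      exact pow_le_pow_left₀ (pow_nonneg (by linarith) _) h3 _
    have h5 : 0 ≤ (1 - rate l) ^ c := pow_nonneg (by linarith) _
    refine le_trans ?_ h4
    nlinarith [mul_nonneg (sq_nonneg ((1 - rate l) ^ c - 1)) (by linarith :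
      0 ≤ (1 - rate l) ^ c + 2)]
  rw [integral_sub ((integrable_pow_hashMismatches H l p t).const_mul _) (integrable_const _),
    integral_const_mul, ← labelProb_isMatch] at h
  simp only [integral_const, probReal_univ, smul_eq_mul, one_mul] at h
  linarith

theorem labelProb_isMatch_le_pow {n : ℕ}
    (h : ∀ π ∈ H.support, n ≤ (hashMismatches p t π).card) :
    labelProb H l p t .isMatch ≤ (1 - rate l) ^ n := by
  have h1 := rate_le_half l
  have h2 := rate_pos l
  rw [labelProb_isMatch]
  calc _ ≤ ∫ _, (1 - rate l) ^ n ∂H.toMeasure := by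
        refine integral_mono_ae (integrable_pow_hashMismatches H l p t) (integrable_const _) ?_
        filter_upwards [ae_mem_support H] with π hπ
        exact pow_le_pow_of_le_one (by linarith) (by linarith) (h π hπ)
    _ = _ := by simp

theorem pow_le_labelProb_isMatch : (1 - rate l) ^ m ≤ labelProb H l p t .isMatch := by
  have h1 := rate_le_half l
  have h2 := rate_pos l
  rw [labelProb_isMatch]
  calc (1 - rate l) ^ m = ∫ _, (1 - rate l) ^ m ∂H.toMeasure := by simp
    _ ≤ _ := by
        refine integral_mono (integrable_const _) (integrable_pow_hashMismatches H l p t)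
          fun π => ?_
        exact pow_le_pow_of_le_one (by linarith) (by linarith)
          ((Finset.card_le_univ _).trans (by simp))

end LabelLaw

/-! ### The dyadic grid of rates. -/

/-- The sequence increases from its first value `1/4`, because `(1 - y/2)^2 ≥ 1 - y`. -/
theorem one_quarter_le_one_sub_half_pow (k : ℕ) :
    (1 / 4 : ℝ) ≤ (1 - (1 / 2) ^ (k + 1)) ^ 2 ^ (k + 1) := by
  induction k with
  | zero => norm_num
  | succ k ih =>
    refine ih.trans ?_
    rw [pow_succ 2 (k + 1), mul_comm, pow_mul]
    have h : (1 / 2 : ℝ) ^ (k + 1) ≤ 1 := pow_le_one₀ (by norm_num) (by norm_num)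
    refine pow_le_pow_left₀ (by linarith) ?_ _
    rw [pow_succ (1 / 2 : ℝ) (k + 1)]
    nlinarith [sq_nonneg ((1 / 2 : ℝ) ^ (k + 1))]

/-- The smallest rate `q` above `1/m` satisfies `m q ≤ 2`, so a call keeps no position at all with
probability at least `(1/4)^2`. This guarantees a rate that comfortably passes the threshold `e⁻⁴
K`. -/
theorem exists_rate_with_large_matchProb {m : ℕ} (hm : 3 ≤ m) :
    ∃ l : RateIdx m, (1 / 16 : ℝ) ≤ (1 - rate l) ^ m := by
  obtain ⟨k, hk1, hk2⟩ : ∃ k, 2 ^ (k + 1) < m ∧ m ≤ 2 ^ (k + 2) := by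
    -- The logarithm of `m - 1` rather than of `m` yields the strict inequality `2 ^ (k + 1) < m`;
    -- `3 ≤ m` keeps the truncated subtraction honest.
    refine ⟨Nat.log 2 (m - 1) - 1, ?_, ?_⟩
    · have h1 : 1 ≤ Nat.log 2 (m - 1) := Nat.log_pos (by norm_num) (by omega)
      rw [Nat.sub_add_cancel h1]
      have := Nat.pow_log_le_self 2 (x := m - 1) (by omega)
      omega
    · have h1 : 1 ≤ Nat.log 2 (m - 1) := Nat.log_pos (by norm_num) (by omega)
      have := Nat.lt_pow_succ_log_self (b := 2) (by norm_num) (m - 1)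
      have h2 : Nat.log 2 (m - 1) - 1 + 2 = (Nat.log 2 (m - 1)).succ := by omega
      rw [h2]
      omega
  have hkm : k < m := by
    have := Nat.lt_two_pow_self (n := k + 1)
    omega
  refine ⟨⟨⟨k, hkm⟩, hk1⟩, ?_⟩
  have h0 : (0 : ℝ) ≤ 1 - (1 / 2) ^ (k + 1) := by
    have : (1 / 2 : ℝ) ^ (k + 1) ≤ 1 := pow_le_one₀ (by norm_num) (by norm_num)
    linarith
  calc (1 / 16 : ℝ) = (1 / 4) ^ 2 := by norm_num
    _ ≤ ((1 - (1 / 2) ^ (k + 1)) ^ 2 ^ (k + 1)) ^ 2 :=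
        pow_le_pow_left₀ (by norm_num) (one_quarter_le_one_sub_half_pow k) _
    _ = (1 - (1 / 2) ^ (k + 1)) ^ 2 ^ (k + 2) := by rw [← pow_mul, ← pow_succ]
    _ ≤ (1 - (1 / 2) ^ (k + 1)) ^ m :=
        pow_le_pow_of_le_one h0 (by linarith [show (0 : ℝ) < (1 / 2) ^ (k + 1) by positivity]) hk2
    _ = _ := by simp [rate]

/-- A rate below `1/2` can be doubled. -/
theorem exists_rate_eq_two_mul {m : ℕ} (l : RateIdx m) (h : rate l ≠ 1 / 2) :
    ∃ l' : RateIdx m, rate l' = 2 * rate l := by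
  obtain ⟨⟨i, hi⟩, hl⟩ := l
  cases i with
  | zero => simp [rate] at h
  | succ i =>
    refine ⟨⟨⟨i, by omega⟩, ?_⟩, ?_⟩
    · exact lt_of_le_of_lt (Nat.pow_le_pow_right (by norm_num) (by simp)) hl
    · simp [rate, pow_succ]
      ring

/-! ### Expectations over finite product spaces. -/

section Expectation

variable {ι L β : Type*} [Fintype ι] [DecidableEq ι] [Fintype L]

/-- The expectation of `F` when the coordinates of `ω` are independent and coordinate `c` has the
law given by the weights `ν c`. -/
def expect (ν : ι → L → ℝ) (F : (ι → L) → ℝ) : ℝ := ∑ ω, (∏ c, ν c (ω c)) * F ω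

variable {ν : ι → L → ℝ}

theorem expect_mono (hν : ∀ c a, 0 ≤ ν c a) {F G : (ι → L) → ℝ} (h : ∀ ω, F ω ≤ G ω) :
    expect ν F ≤ expect ν G :=
  Finset.sum_le_sum fun ω _ =>
    mul_le_mul_of_nonneg_left (h ω) (Finset.prod_nonneg fun c _ => hν c _)

theorem expect_add (F G : (ι → L) → ℝ) :
    expect ν (fun ω => F ω + G ω) = expect ν F + expect ν G := by
  simp [expect, mul_add, Finset.sum_add_distrib]

theorem expect_const_mul (a : ℝ) (F : (ι → L) → ℝ) :
    expect ν (fun ω => a * F ω) = a * expect ν F := by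
  simp only [expect, Finset.mul_sum]
  exact Finset.sum_congr rfl fun ω _ => by ring

theorem expect_sum {α : Type*} (s : Finset α) (F : α → (ι → L) → ℝ) :
    expect ν (fun ω => ∑ i ∈ s, F i ω) = ∑ i ∈ s, expect ν (F i) := by
  simp only [expect, Finset.mul_sum]
  exact Finset.sum_comm

theorem expect_prod (f : ι → L → ℝ) :
    expect ν (fun ω => ∏ c, f c (ω c)) = ∏ c, ∑ a, ν c a * f c a := by
  simp only [expect, ← Finset.prod_mul_distrib]
  rw [Finset.prod_univ_sum, Fintype.piFinset_univ]

theorem expect_one (hs : ∀ c, ∑ a, ν c a = 1) : expect ν (fun _ => 1) = 1 := by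
  have := expect_prod (ν := ν) (fun _ _ => 1)
  simpa [hs] using this

/-- If `g` and the factor at its coordinate are negatively correlated, then the expectation of
the product is at most the product of the expectations. -/
theorem expect_mul_prod_le (hν : ∀ c a, 0 ≤ ν c a) (c₀ : ι) (g : L → ℝ) {h : ι → L → ℝ}
    (hh : ∀ c a, 0 ≤ h c a)
    (hc : ∑ a, ν c₀ a * (g a * h c₀ a) ≤ (∑ a, ν c₀ a * g a) * ∑ a, ν c₀ a * h c₀ a) :
    expect ν (fun ω => g (ω c₀) * ∏ c, h c (ω c)) ≤
      (∑ a, ν c₀ a * g a) * ∏ c, ∑ a, ν c a * h c a := by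
  have h1 : ∀ ω : ι → L, g (ω c₀) * ∏ c, h c (ω c) =
      ∏ c, (if c = c₀ then g (ω c) * h c (ω c) else h c (ω c)) := by
    intro ω
    rw [← Finset.mul_prod_erase _ _ (Finset.mem_univ c₀),
      ← Finset.mul_prod_erase _ _ (Finset.mem_univ c₀), if_pos rfl, mul_assoc]
    congr 2
    exact Finset.prod_congr rfl fun c hc => (if_neg (Finset.ne_of_mem_erase hc)).symm
  simp only [h1]
  rw [expect_prod (fun c a => if c = c₀ then g a * h c a else h c a),
    ← Finset.mul_prod_erase _ _ (Finset.mem_univ c₀),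
    ← Finset.mul_prod_erase _ (fun c => ∑ a, ν c a * h c a) (Finset.mem_univ c₀), ← mul_assoc]
  have h2 : ∏ c ∈ Finset.univ.erase c₀, ∑ a, ν c a * (if c = c₀ then g a * h c a else h c a) =
      ∏ c ∈ Finset.univ.erase c₀, ∑ a, ν c a * h c a :=
    Finset.prod_congr rfl fun c hc => by simp [Finset.ne_of_mem_erase hc]
  rw [h2]
  refine mul_le_mul_of_nonneg_right (by simpa using hc) ?_
  exact Finset.prod_nonneg fun c _ => Finset.sum_nonneg fun a _ => mul_nonneg (hν c a) (hh c a)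

/-- A product whose factors depend on all values `hit (ω c)`, but otherwise each on its own
coordinate, has expectation at most one if this holds conditionally on the values `hit (ω c)`. -/
theorem expect_prod_le_one_of_fiber [Fintype β] [DecidableEq β] (hν : ∀ c a, 0 ≤ ν c a)
    (hs : ∀ c, ∑ a, ν c a = 1) (hit : L → β) (f : (ι → β) → ι → L → ℝ)
    (hf : ∀ z c a, 0 ≤ f z c a)
    (h : ∀ z c, ∑ a, ν c a * (if hit a = z c then f z c a else 0) ≤
      ∑ a, ν c a * (if hit a = z c then 1 else 0)) :
    expect ν (fun ω => ∏ c, f (fun c => hit (ω c)) c (ω c)) ≤ 1 := by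
  -- Decomposition over all hit patterns `z`: only the actual pattern of `ω` contributes, and for
  -- fixed `z` the factors depend on separate coordinates.
  have key : ∀ (F : (ι → β) → ι → L → ℝ) (ω : ι → L),
      ∏ c, F (fun c => hit (ω c)) c (ω c) =
        ∑ z : ι → β, ∏ c, (if hit (ω c) = z c then F z c (ω c) else 0) := by
    intro F ω
    rw [Finset.sum_eq_single (fun c => hit (ω c))]
    · simp
    · intro z _ hz
      obtain ⟨c, hc⟩ := Function.ne_iff.1 hz
      exact Finset.prod_eq_zero (Finset.mem_univ c) (if_neg (Ne.symm hc))
    · simp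
  have gen : ∀ F : (ι → β) → ι → L → ℝ,
      expect ν (fun ω => ∏ c, F (fun c => hit (ω c)) c (ω c)) =
        ∑ z : ι → β, ∏ c, ∑ a, ν c a * (if hit a = z c then F z c a else 0) := by
    intro F
    simp only [key F]
    rw [expect_sum]
    exact Finset.sum_congr rfl fun z _ =>
      expect_prod (fun c a => if hit a = z c then F z c a else 0)
  have h3 := gen fun _ _ _ => 1
  simp only [Finset.prod_const_one] at h3
  rw [gen f, ← expect_one hs, h3]
  refine Finset.sum_le_sum fun z _ => Finset.prod_le_prod (fun c _ => ?_) fun c _ => h z c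
  refine Finset.sum_nonneg fun a _ => mul_nonneg (hν c a) ?_
  split_ifs
  exacts [hf _ _ _, le_rfl]

/-- The probability of an event in the product space. -/
def prob (ν : ι → L → ℝ) (E : Set (ι → L)) : ℝ := expect ν (E.indicator fun _ => 1)

theorem prob_le_expect (hν : ∀ c a, 0 ≤ ν c a) {E : Set (ι → L)} {F : (ι → L) → ℝ}
    (h0 : ∀ ω, 0 ≤ F ω) (h : ∀ ω ∈ E, 1 ≤ F ω) : prob ν E ≤ expect ν F := by
  refine expect_mono hν fun ω => ?_
  by_cases hω : ω ∈ E <;> simp [hω, h, h0]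

theorem prob_le_expect_div (hν : ∀ c a, 0 ≤ ν c a) {E : Set (ι → L)} {F : (ι → L) → ℝ}
    {b : ℝ} (hb : 0 < b) (h0 : ∀ ω, 0 ≤ F ω) (h : ∀ ω ∈ E, b ≤ F ω) :
    prob ν E ≤ expect ν F / b := by
  have := prob_le_expect hν (E := E) (F := fun ω => b⁻¹ * F ω)
    (fun ω => mul_nonneg (inv_nonneg.2 hb.le) (h0 ω))
    (fun ω hω => by rw [inv_mul_eq_div, one_le_div hb]; exact h ω hω)
  rwa [expect_const_mul, inv_mul_eq_div] at this

theorem prob_mono (hν : ∀ c a, 0 ≤ ν c a) {E E' : Set (ι → L)} (h : E ⊆ E') :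
    prob ν E ≤ prob ν E' :=
  expect_mono hν fun _ => Set.indicator_le_indicator_of_subset h (fun _ => zero_le_one) _

theorem prob_union_le (hν : ∀ c a, 0 ≤ ν c a) (E E' : Set (ι → L)) :
    prob ν (E ∪ E') ≤ prob ν E + prob ν E' := by
  unfold prob
  rw [← expect_add]
  refine expect_mono hν fun ω => ?_
  by_cases h : ω ∈ E <;> by_cases h' : ω ∈ E' <;> simp [h, h']

/-- The product measure of finitely many laws on a finite type, in terms of `prob`. -/
theorem pi_real_eq_prob [MeasurableSpace L] [MeasurableSingletonClass L]
    (μ : ι → Measure L) [∀ c, IsProbabilityMeasure (μ c)] (E : Set (ι → L)) :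
    (Measure.pi μ).real E = prob (fun c a => (μ c).real {a}) E := by
  classical
  have hE : E = ((Finset.univ.filter (· ∈ E) : Finset (ι → L)) : Set (ι → L)) := by simp
  conv_lhs => rw [hE]
  rw [← sum_measureReal_singleton]
  simp only [prob, expect, Set.indicator_apply, mul_ite, mul_one, mul_zero]
  rw [Finset.sum_filter]
  refine Finset.sum_congr rfl fun ω _ => ?_
  split_ifs
  · rw [measureReal_def, Measure.pi_singleton, ENNReal.toReal_prod]
    rfl
  · rfl

end Expectation

/-! ### The abstract call model and its exponential moments. -/

/-- The law of the calls of a sampling procedure at scales `κ` and rates `R`: an answer in `L` is a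
hit, or has a value at most twice the scale, and the mean value is the target `w`, up to the odds
of the rate and the probability of a hit. -/
structure CallModel (κ R L : Type*) [Fintype L] where
  law : κ → R → L → ℝ
  law_nonneg : ∀ k l a, 0 ≤ law k l a
  law_sum : ∀ k l, ∑ a, law k l a = 1
  hit : L → Bool
  val : κ → L → ℝ
  val_nonneg : ∀ k a, 0 ≤ val k a
  val_hit : ∀ k a, hit a = true → val k a = 0
  D : κ → ℝ
  D_pos : ∀ k, 0 < D k
  val_le : ∀ k a, val k a ≤ 2 * D k
  q : R → ℝ
  q_pos : ∀ l, 0 < q l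
  q_le : ∀ l, q l ≤ 1 / 2
  w : κ → ℝ
  w_nonneg : ∀ k, 0 ≤ w k
  mean_val : ∀ k l, (1 - q l) * ∑ a, law k l a * val k a =
    q l * (∑ a, law k l a * if hit a then 1 else 0) * w k

theorem exp_le_one_add_add_sq {x : ℝ} (hx : |x| ≤ 1) : Real.exp x ≤ 1 + x + x ^ 2 := by
  have := (abs_le.1 (Real.abs_exp_sub_one_sub_id_le hx)).2
  linarith

namespace CallModel

variable {κ R L : Type*} [Fintype L] (M : CallModel κ R L) {K : ℕ}

/-- The indicator of a hit. -/
def ind (a : L) : ℝ := if M.hit a then 1 else 0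

/-- The probability of a hit. -/
def p (k : κ) (l : R) : ℝ := ∑ a, M.law k l a * M.ind a

/-- The mean value of an answer. -/
def mean (k : κ) (l : R) : ℝ := ∑ a, M.law k l a * M.val k a

/-- The mean value of an answer that is not a hit. -/
def condMean (k : κ) (l : R) : ℝ := M.mean k l / (1 - M.p k l)

/-- The laws of all calls. -/
def laws (K : ℕ) (c : κ × R × Fin K) : L → ℝ := M.law c.1 c.2.1

/-- The number of hits at a scale and a rate. -/
def cnt (ω : κ × R × Fin K → L) (k : κ) (l : R) : ℕ := ∑ r, if M.hit (ω (k, l, r)) then 1 else 0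

/-- The sum of the values at a scale and a rate. -/
def tot (ω : κ × R × Fin K → L) (k : κ) (l : R) : ℝ := ∑ r, M.val k (ω (k, l, r))

theorem laws_nonneg (c : κ × R × Fin K) (a : L) : 0 ≤ M.laws K c a := M.law_nonneg _ _ _

theorem laws_sum (c : κ × R × Fin K) : ∑ a, M.laws K c a = 1 := M.law_sum _ _

theorem ind_nonneg (a : L) : 0 ≤ M.ind a := by
  unfold ind; split_ifs <;> norm_num

theorem ind_le_one (a : L) : M.ind a ≤ 1 := by
  unfold ind; split_ifs <;> norm_num

theorem p_nonneg (k : κ) (l : R) : 0 ≤ M.p k l :=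
  Finset.sum_nonneg fun a _ => mul_nonneg (M.law_nonneg k l a) (M.ind_nonneg a)

theorem p_le_one (k : κ) (l : R) : M.p k l ≤ 1 := by
  rw [← M.law_sum k l]
  exact Finset.sum_le_sum fun a _ => mul_le_of_le_one_right (M.law_nonneg k l a) (M.ind_le_one a)

theorem mean_nonneg (k : κ) (l : R) : 0 ≤ M.mean k l :=
  Finset.sum_nonneg fun a _ => mul_nonneg (M.law_nonneg k l a) (M.val_nonneg k a)

theorem condMean_nonneg (k : κ) (l : R) : 0 ≤ M.condMean k l :=
  div_nonneg (M.mean_nonneg k l) (sub_nonneg.2 (M.p_le_one k l))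

theorem mean_eq (k : κ) (l : R) : (1 - M.q l) * M.mean k l = M.q l * M.p k l * M.w k :=
  M.mean_val k l

theorem cast_cnt (ω : κ × R × Fin K → L) (k : κ) (l : R) :
    (M.cnt ω k l : ℝ) = ∑ r, M.ind (ω (k, l, r)) := by
  simp [cnt, ind]

theorem cnt_le (ω : κ × R × Fin K → L) (k : κ) (l : R) : (M.cnt ω k l : ℝ) ≤ K := by
  rw [cast_cnt]
  exact (Finset.sum_le_sum fun r _ => M.ind_le_one _).trans (by simp)

theorem tot_nonneg (ω : κ × R × Fin K → L) (k : κ) (l : R) : 0 ≤ M.tot ω k l :=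
  Finset.sum_nonneg fun _ _ => M.val_nonneg _ _

theorem sum_law_mul_affine_ind (k : κ) (l : R) (a b : ℝ) :
    ∑ x, M.law k l x * (a + b * M.ind x) = a + b * M.p k l := by
  simp only [mul_add, Finset.sum_add_distrib, ← Finset.sum_mul, M.law_sum, one_mul, p,
    Finset.mul_sum]
  congr 1
  exact Finset.sum_congr rfl fun x _ => by ring

/-- A Bernstein bound for one call on the event of no hit. With `e^y ≤ 1 + y + y²` for `|y| ≤ 1` and
`val² ≤ 2D · val`, the exponential is at most affine in the value; its mean is then absorbed by `1 +
y ≤ e^y`. The second-order term is proportional to the conditional mean, not to `D²`. The case `s =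
0` is separate because `condMean` divides by `1 - p`. -/
theorem sum_law_exp_le {k : κ} {l : R} {s : ℝ} (hs : |s| * (2 * M.D k) ≤ 1)
    (h : s ≠ 0 → M.p k l < 1) :
    ∑ a, M.law k l a * ((1 - M.ind a) * Real.exp (s * (M.val k a - M.condMean k l) -
      s ^ 2 * (2 * M.D k) * M.condMean k l)) ≤ 1 - M.p k l := by
  have h0 : ∑ a, M.law k l a * (1 - M.ind a) = 1 - M.p k l := by
    have := M.sum_law_mul_affine_ind k l 1 (-1)
    simp only [neg_mul, one_mul, ← sub_eq_add_neg] at this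
    exact this
  rcases eq_or_ne s 0 with rfl | hs0
  · simp [h0]
  have hp : 0 < 1 - M.p k l := sub_pos.2 (h hs0)
  have hmean : (1 - M.p k l) * M.condMean k l = M.mean k l := by
    unfold condMean
    field_simp
  set μ := M.condMean k l
  have hD := M.D_pos k
  have hval : ∀ a, M.law k l a * ((1 - M.ind a) * Real.exp (s * (M.val k a - μ) -
      s ^ 2 * (2 * M.D k) * μ)) ≤ Real.exp (-(s + s ^ 2 * (2 * M.D k)) * μ) *
      (M.law k l a * (1 - M.ind a) + (s + s ^ 2 * (2 * M.D k)) * (M.law k l a * M.val k a)) := by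
    intro a
    have h1 : s * (M.val k a - μ) - s ^ 2 * (2 * M.D k) * μ =
        -(s + s ^ 2 * (2 * M.D k)) * μ + s * M.val k a := by ring
    rw [h1, Real.exp_add]
    have hv0 := M.val_nonneg k a
    have hv1 := M.val_le k a
    have h2 : Real.exp (s * M.val k a) ≤ 1 + s * M.val k a + (s * M.val k a) ^ 2 := by
      refine exp_le_one_add_add_sq ?_
      rw [abs_mul, abs_of_nonneg hv0]
      exact (mul_le_mul_of_nonneg_left hv1 (abs_nonneg s)).trans hs
    have h3 : (s * M.val k a) ^ 2 ≤ s ^ 2 * (2 * M.D k) * M.val k a := by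
      rw [mul_pow, mul_assoc]
      refine mul_le_mul_of_nonneg_left ?_ (sq_nonneg s)
      nlinarith
    have h4 : (1 - M.ind a) * M.val k a = M.val k a := by
      unfold ind
      split_ifs with hh
      · simp [M.val_hit k a hh]
      · simp
    have h5 : (1 - M.ind a) * Real.exp (s * M.val k a) ≤
        (1 - M.ind a) + (s + s ^ 2 * (2 * M.D k)) * M.val k a := by
      calc _ ≤ (1 - M.ind a) * (1 + (s + s ^ 2 * (2 * M.D k)) * M.val k a) :=
            mul_le_mul_of_nonneg_left (by linarith) (sub_nonneg.2 (M.ind_le_one a))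
        _ = (1 - M.ind a) + (s + s ^ 2 * (2 * M.D k)) * ((1 - M.ind a) * M.val k a) := by ring
        _ = _ := by rw [h4]
    have h6 := mul_le_mul_of_nonneg_left h5
      (mul_nonneg (Real.exp_pos (-(s + s ^ 2 * (2 * M.D k)) * μ)).le (M.law_nonneg k l a))
    calc _ = _ := by ring
      _ ≤ _ := h6
      _ = _ := by ring
  refine (Finset.sum_le_sum fun a _ => hval a).trans ?_
  rw [← Finset.mul_sum, Finset.sum_add_distrib, h0, ← Finset.mul_sum]
  change Real.exp _ * (1 - M.p k l + _ * M.mean k l) ≤ _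
  rw [← hmean, neg_mul, Real.exp_neg, inv_mul_le_iff₀ (Real.exp_pos _)]
  have := Real.add_one_le_exp ((s + s ^ 2 * (2 * M.D k)) * μ)
  nlinarith [mul_le_mul_of_nonneg_right this hp.le]

variable [Fintype κ] [Fintype R] [DecidableEq κ] [DecidableEq R]

/-- An exponential supermartingale bound: conditionally on all hits, the centred values have
sub-exponential tails, with coefficients that may depend on the numbers of hits. -/
theorem expect_exp_centred_le_one (s : (κ → R → ℕ) → κ → R → ℝ)
    (hs : ∀ N k l, |s N k l| * (2 * M.D k) ≤ 1) (h : ∀ N k l, s N k l ≠ 0 → M.p k l < 1) :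
    expect (M.laws K) (fun ω => Real.exp (∑ k, ∑ l,
      (s (M.cnt ω) k l * (M.tot ω k l - M.condMean k l * (K - M.cnt ω k l)) -
        s (M.cnt ω) k l ^ 2 * (2 * M.D k) * (M.condMean k l * (K - M.cnt ω k l))))) ≤ 1 := by
  -- The coefficients are functions of the hit pattern alone, so they are constants on each fibre;
  -- this is what permits a data-dependent rate.
  set S : (κ × R × Fin K → Bool) → κ → R → ℝ := fun z =>
    s fun k l => ∑ r, if z (k, l, r) then 1 else 0 with hS
  set f : (κ × R × Fin K → Bool) → κ × R × Fin K → L → ℝ := fun z c a =>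
    Real.exp (S z c.1 c.2.1 * (M.val c.1 a - M.condMean c.1 c.2.1 * (1 - M.ind a)) -
      S z c.1 c.2.1 ^ 2 * (2 * M.D c.1) * (M.condMean c.1 c.2.1 * (1 - M.ind a))) with hf
  have key := expect_prod_le_one_of_fiber (ν := M.laws K) M.laws_nonneg M.laws_sum M.hit f
    (fun z c a => (Real.exp_pos _).le) ?_
  · refine le_of_eq_of_le ?_ key
    congr 1
    ext ω
    rw [hf, ← Real.exp_sum, Fintype.sum_prod_type]
    simp only [Fintype.sum_prod_type]
    congr 1
    refine Finset.sum_congr rfl fun k _ => Finset.sum_congr rfl fun l _ => ?_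
    change _ = ∑ r, (s (M.cnt ω) k l * _ - s (M.cnt ω) k l ^ 2 * _ * _)
    rw [Finset.sum_sub_distrib, ← Finset.mul_sum, ← Finset.mul_sum, Finset.sum_sub_distrib,
      ← Finset.mul_sum, Finset.sum_sub_distrib, ← M.cast_cnt, Finset.sum_const,
      Finset.card_univ, Fintype.card_fin, nsmul_eq_mul, mul_one]
    rfl
  · rintro z ⟨k, l, r⟩
    cases hz : z (k, l, r)
    · have h1 := M.sum_law_exp_le (hs (fun k l => ∑ r, if z (k, l, r) then 1 else 0) k l) (h _ k l)
      have h2 := M.sum_law_mul_affine_ind k l 1 (-1)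
      simp only [neg_mul, one_mul, ← sub_eq_add_neg] at h2
      calc _ = _ := ?_
        _ ≤ _ := h1
        _ = _ := h2.symm
        _ = _ := ?_
      · refine Finset.sum_congr rfl fun a _ => ?_
        cases ha : M.hit a
        · simp [laws, hf, ha, ind, hS]
        · simp [ha, ind]
      · refine Finset.sum_congr rfl fun a _ => ?_
        cases ha : M.hit a
        · simp [laws, ha, ind]
        · simp [ha, ind]
    · refine Finset.sum_le_sum fun a _ => ?_
      cases ha : M.hit a
      · simp
      · simp [hf, ha, ind, M.val_hit]

end CallModel

/-! ### Numerical bounds on the selection threshold. -/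

theorem exp_four_eq : Real.exp 4 = Real.exp 1 ^ 4 := by
  rw [← Real.exp_nat_mul]
  norm_num

theorem exp_four_lt : Real.exp 4 < 55 := by
  rw [exp_four_eq]
  calc Real.exp 1 ^ 4 < 2.7182818286 ^ 4 :=
        pow_lt_pow_left₀ Real.exp_one_lt_d9 (Real.exp_pos _).le (by norm_num)
    _ < 55 := by norm_num

theorem lt_exp_four : 54 < Real.exp 4 := by
  rw [exp_four_eq]
  calc (54 : ℝ) < 2.7182818283 ^ 4 := by norm_num
    _ < Real.exp 1 ^ 4 := pow_lt_pow_left₀ Real.exp_one_gt_d9 (by norm_num) (by norm_num)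

theorem exp_neg_four_lt : Real.exp (-4) < 1 / 54 := by
  rw [Real.exp_neg, ← one_div]
  exact one_div_lt_one_div_of_lt (by norm_num) lt_exp_four

theorem lt_exp_neg_four : 1 / 55 < Real.exp (-4) := by
  rw [Real.exp_neg, ← one_div]
  exact one_div_lt_one_div_of_lt (Real.exp_pos _) exp_four_lt

/-! ### Deviations of the hit counts, and estimates on a selection event. -/

namespace CallModel

variable {κ R L : Type*} [Fintype L] (M : CallModel κ R L) {K : ℕ}

theorem sum_law_exp_centred_ind_le (k : κ) (l : R) {h : ℝ} (hh : |h| ≤ 1) :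
    ∑ a, M.law k l a * Real.exp (h * (M.ind a - M.p k l)) ≤ Real.exp (h ^ 2) := by
  have h0 := M.p_nonneg k l
  have h1 := M.p_le_one k l
  calc _ ≤ ∑ a, M.law k l a * ((1 + h ^ 2 - h * M.p k l) + h * M.ind a) := by
        refine Finset.sum_le_sum fun a _ => mul_le_mul_of_nonneg_left ?_ (M.law_nonneg k l a)
        have hd : |M.ind a - M.p k l| ≤ 1 := by
          have := M.ind_nonneg a
          have := M.ind_le_one a
          rw [abs_le]
          constructor <;> linarith
        have hd2 : |h * (M.ind a - M.p k l)| ≤ |h| := by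
          rw [abs_mul]
          exact mul_le_of_le_one_right (abs_nonneg h) hd
        have := exp_le_one_add_add_sq (hd2.trans hh)
        have h3 := sq_le_sq' (neg_le_of_abs_le hd2) (le_of_abs_le hd2)
        rw [sq_abs] at h3
        linarith
    _ = 1 + h ^ 2 := by
        rw [M.sum_law_mul_affine_ind]
        ring
    _ ≤ _ := by
        have := Real.add_one_le_exp (h ^ 2)
        linarith

/-- The requirement on the choice of a rate from the numbers of hits. -/
def IsRule (K : ℕ) (sel : (R → ℕ) → Option R) : Prop :=
  ∀ c : R → ℕ, (∀ l, sel c = some l → Real.exp (-4) * K ≤ c l ∧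
      ∀ l', Real.exp (-4) * K ≤ c l' → M.q l' * c l' ≤ M.q l * c l) ∧
    (sel c = none → ∀ l, ¬ Real.exp (-4) * K ≤ c l)

/-- The estimate at a scale and a rate. -/
def rateEst (ω : κ × R × Fin K → L) (k : κ) (l : R) : ℝ :=
  (1 - M.q l) / (M.q l * M.cnt ω k l) * M.tot ω k l

/-- The estimate at a scale. -/
def est (sel : (R → ℕ) → Option R) (ω : κ × R × Fin K → L) (k : κ) : ℝ :=
  (sel (M.cnt ω k)).elim 0 (M.rateEst ω k)

theorem rateEst_nonneg (ω : κ × R × Fin K → L) (k : κ) (l : R) : 0 ≤ M.rateEst ω k l := by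
  have h1 := M.q_pos l
  have h2 := M.q_le l
  exact mul_nonneg (div_nonneg (by linarith) (by positivity)) (M.tot_nonneg ω k l)

theorem est_nonneg (sel : (R → ℕ) → Option R) (ω : κ × R × Fin K → L) (k : κ) :
    0 ≤ M.est sel ω k := by
  unfold est
  cases sel (M.cnt ω k)
  · exact le_rfl
  · exact M.rateEst_nonneg ω k _

variable [Fintype κ] [Fintype R] [DecidableEq κ] [DecidableEq R]

theorem prod_ite_call (k : κ) (l : R) (G : κ × R × Fin K → ℝ) :
    ∏ c, (if c.1 = k ∧ c.2.1 = l then G c else 1) = ∏ r, G (k, l, r) := by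
  rw [Fintype.prod_prod_type, Finset.prod_eq_single k, Fintype.prod_prod_type,
    Finset.prod_eq_single l]
  · simp
  · intro l' _ hl
    simp [hl]
  · simp
  · intro k' _ hk
    simp [hk]
  · simp

theorem expect_prod_calls (k : κ) (l : R) (g : L → ℝ) :
    expect (M.laws K) (fun ω => ∏ r, g (ω (k, l, r))) = (∑ a, M.law k l a * g a) ^ K := by
  have h : ∀ ω : κ × R × Fin K → L, ∏ r, g (ω (k, l, r)) =
      ∏ c, (if c.1 = k ∧ c.2.1 = l then g (ω c) else 1) := fun ω =>
    (prod_ite_call k l fun c => g (ω c)).symm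
  simp only [h]
  rw [expect_prod (fun (c : κ × R × Fin K) a => if c.1 = k ∧ c.2.1 = l then g a else 1)]
  have h2 : ∀ c : κ × R × Fin K, ∑ a, M.laws K c a *
      (if c.1 = k ∧ c.2.1 = l then g a else 1) =
      if c.1 = k ∧ c.2.1 = l then ∑ a, M.laws K c a * g a else 1 := by
    intro c
    split_ifs
    · rfl
    · simp [M.laws_sum]
  simp only [h2]
  rw [prod_ite_call k l fun c => ∑ a, M.laws K c a * g a]
  simp [laws]

/-- For `l' ≠ l` the value and the product are independent. For `l' = l` they share a single call,
and negative correlation within that call suffices. -/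
theorem expect_val_mul_prod_calls_le (k : κ) (l l' : R) (r₀ : Fin K) {g : L → ℝ}
    (hg : ∀ a, 0 ≤ g a) (hc : l' = l → ∑ a, M.law k l a * (M.val k a * g a) ≤
      M.mean k l * ∑ a, M.law k l a * g a) :
    expect (M.laws K) (fun ω => M.val k (ω (k, l, r₀)) * ∏ r, g (ω (k, l', r))) ≤
      M.mean k l * (∑ a, M.law k l' a * g a) ^ K := by
  have h : ∀ ω : κ × R × Fin K → L, ∏ r, g (ω (k, l', r)) =
      ∏ c, (if c.1 = k ∧ c.2.1 = l' then g (ω c) else 1) := fun ω =>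
    (prod_ite_call k l' fun c => g (ω c)).symm
  rw [← expect_prod_calls]
  simp only [h]
  rw [expect_prod (fun (c : κ × R × Fin K) a => if c.1 = k ∧ c.2.1 = l' then g a else 1)]
  refine expect_mul_prod_le M.laws_nonneg (k, l, r₀) (M.val k)
    (h := fun c a => if c.1 = k ∧ c.2.1 = l' then g a else 1) ?_ ?_
  · intro c a
    split_ifs
    exacts [hg a, zero_le_one]
  · rcases eq_or_ne l' l with rfl | hl
    · simpa [laws, mean] using hc rfl
    · simp [hl.symm, M.laws_sum]

theorem expect_exp_cnt_le (k : κ) (l : R) {h : ℝ} (hh : |h| ≤ 1) :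
    expect (M.laws K) (fun ω => Real.exp (h * (M.cnt ω k l - M.p k l * K))) ≤
      Real.exp (K * h ^ 2) := by
  have h1 : ∀ ω : κ × R × Fin K → L, Real.exp (h * (M.cnt ω k l - M.p k l * K)) =
      ∏ r, Real.exp (h * (M.ind (ω (k, l, r)) - M.p k l)) := by
    intro ω
    rw [← Real.exp_sum, ← Finset.mul_sum, Finset.sum_sub_distrib, M.cast_cnt]
    simp [mul_comm]
  simp only [h1]
  rw [M.expect_prod_calls k l (fun a => Real.exp (h * (M.ind a - M.p k l))), Real.exp_nat_mul]
  exact pow_le_pow_left₀ (Finset.sum_nonneg fun a _ =>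
    mul_nonneg (M.law_nonneg _ _ _) (Real.exp_pos _).le) (M.sum_law_exp_centred_ind_le k l hh) _

theorem expect_exp_abs_cnt_le (k : κ) (l : R) {h : ℝ} (h0 : 0 ≤ h) (hh : h ≤ 1) :
    expect (M.laws K) (fun ω => Real.exp (h * |M.cnt ω k l - M.p k l * K|)) ≤
      2 * Real.exp (K * h ^ 2) := by
  have h1 := M.expect_exp_cnt_le (K := K) k l (h := h) (by rwa [abs_of_nonneg h0])
  have h2 := M.expect_exp_cnt_le (K := K) k l (h := -h) (by rwa [abs_neg, abs_of_nonneg h0])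
  rw [neg_sq] at h2
  rw [two_mul]
  refine le_trans ?_ (add_le_add h1 h2)
  rw [← expect_add]
  refine expect_mono M.laws_nonneg fun ω => ?_
  have e1 := Real.exp_pos (h * (M.cnt ω k l - M.p k l * K))
  have e2 := Real.exp_pos (-h * (M.cnt ω k l - M.p k l * K))
  rcases abs_cases ((M.cnt ω k l : ℝ) - M.p k l * K) with ⟨he, _⟩ | ⟨he, _⟩ <;> rw [he]
  · linarith
  · rw [mul_neg, ← neg_mul]
    linarith

theorem prob_cnt_deviation_le (k : κ) (l : R) {δ : ℝ} (h0 : 0 ≤ δ) (h2 : δ ≤ 2) :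
    prob (M.laws K) {ω | δ * K ≤ |M.cnt ω k l - M.p k l * K|} ≤
      2 * Real.exp (-(K * δ ^ 2 / 4)) := by
  have h1 := M.expect_exp_abs_cnt_le (K := K) k l (h := δ / 2) (by linarith) (by linarith)
  have h3 := prob_le_expect_div (M.laws_nonneg (K := K))
    (E := {ω | δ * K ≤ |M.cnt ω k l - M.p k l * K|})
    (F := fun ω => Real.exp (δ / 2 * |M.cnt ω k l - M.p k l * K|))
    (Real.exp_pos (δ / 2 * (δ * K))) (fun ω => (Real.exp_pos _).le)
    (fun ω hω => Real.exp_le_exp.2 (mul_le_mul_of_nonneg_left hω (by linarith)))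
  refine h3.trans ?_
  rw [div_le_iff₀ (Real.exp_pos _), mul_assoc, ← Real.exp_add]
  rwa [show -(K * δ ^ 2 / 4) + δ / 2 * (δ * K) = K * (δ / 2) ^ 2 by ring]

/-- The expected deviation of the number of hits, beyond a threshold. -/
theorem expect_cnt_excess_le (k : κ) (l : R) {δ : ℝ} (h0 : 0 < δ) (h2 : δ ≤ 2)
    (hK : 2 ≤ K * δ ^ 2) :
    expect (M.laws K) (fun ω => if δ * K ≤ |M.cnt ω k l - M.p k l * K| then
      |M.cnt ω k l - M.p k l * K| else 0) ≤ 2 * (δ * K) * Real.exp (-(K * δ ^ 2 / 4)) := by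
  have h1 := M.expect_exp_abs_cnt_le (K := K) k l (h := δ / 2) (by linarith) (by linarith)
  have hK0 : (0 : ℝ) < K := by
    by_contra h
    have : (K : ℝ) = 0 := le_antisymm (not_lt.1 h) (Nat.cast_nonneg K)
    rw [this] at hK
    norm_num at hK
  have hδK : 0 < δ * K := mul_pos h0 hK0
  have h3 : expect (M.laws K) (fun ω => if δ * K ≤ |M.cnt ω k l - M.p k l * K| then
      |M.cnt ω k l - M.p k l * K| else 0) ≤ expect (M.laws K) (fun ω =>
      (δ * K * Real.exp (-(K * δ ^ 2 / 2))) *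
        Real.exp (δ / 2 * |M.cnt ω k l - M.p k l * K|)) := by
    refine expect_mono M.laws_nonneg fun ω => ?_
    split_ifs with hX
    · set X := |(M.cnt ω k l : ℝ) - M.p k l * K|
      rw [mul_assoc, ← Real.exp_add]
      -- The bound `y ≤ e^(y-1)` for `y = X / (δ K) ≥ 1`; since `K δ² / 2 ≥ 1`, the exponent may be
      -- enlarged by that factor to match the exponential moment.
      have h4 := Real.add_one_le_exp (X / (δ * K) - 1)
      have h5 : X / (δ * K) - 1 ≤ -(K * δ ^ 2 / 2) + δ / 2 * X := by
        have h6 : 0 ≤ X / (δ * K) - 1 := by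
          rw [sub_nonneg, one_le_div hδK]
          exact hX
        have h7 : -(K * δ ^ 2 / 2) + δ / 2 * X = (K * δ ^ 2 / 2) * (X / (δ * K) - 1) := by
          field_simp
          ring
        rw [h7]
        exact le_mul_of_one_le_left h6 (by linarith)
      have h8 : X / (δ * K) ≤ Real.exp (-(K * δ ^ 2 / 2) + δ / 2 * X) := by
        have := Real.exp_le_exp.2 h5
        linarith
      rw [div_le_iff₀ hδK] at h8
      linarith
    · positivity
  refine h3.trans ?_
  rw [expect_const_mul]
  have h9 := mul_le_mul_of_nonneg_left h1
    (mul_nonneg hδK.le (Real.exp_pos (-(K * δ ^ 2 / 2))).le)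
  refine h9.trans_eq ?_
  have h10 : -(K * δ ^ 2 / 4) = -(K * δ ^ 2 / 2) + K * (δ / 2) ^ 2 := by ring
  rw [h10, Real.exp_add]
  ring

/-- The expected estimate plus target, on the event that a rate is selected, if this event is
contained in an event with a product-form exponential bound. -/
theorem expect_selected_le {sel : (R → ℕ) → Option R} (hsel : M.IsRule K sel) (hK : 0 < K)
    (k : κ) (l l' : R) {g : L → ℝ} (hg : ∀ a, 0 ≤ g a) {γ : ℝ}
    (hγ : ∑ a, M.law k l' a * g a ≤ γ)
    (hc : l' = l → ∑ a, M.law k l a * (M.val k a * g a) ≤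
      M.mean k l * ∑ a, M.law k l a * g a)
    (hE : ∀ ω : κ × R × Fin K → L, sel (M.cnt ω k) = some l → 1 ≤ ∏ r, g (ω (k, l', r))) :
    expect (M.laws K) (fun ω => if sel (M.cnt ω k) = some l then M.rateEst ω k l + M.w k else 0) ≤
      56 * M.w k * γ ^ K := by
  have hK' : (0 : ℝ) < K := by exact_mod_cast hK
  have hq := M.q_pos l
  have hq2 := M.q_le l
  set α := (1 - M.q l) / M.q l * Real.exp 4 / K with hα
  have hα0 : 0 ≤ α := by
    have : 0 ≤ 1 - M.q l := by linarith
    positivity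
  have h1 : ∀ ω : κ × R × Fin K → L,
      (if sel (M.cnt ω k) = some l then M.rateEst ω k l + M.w k else 0) ≤
      α * (∑ r₀, M.val k (ω (k, l, r₀)) * ∏ r, g (ω (k, l', r))) +
        M.w k * ∏ r, g (ω (k, l', r)) := by
    intro ω
    have hP : 0 ≤ ∏ r, g (ω (k, l', r)) := Finset.prod_nonneg fun r _ => hg _
    split_ifs with hs
    · have h2 := hE ω hs
      have h3 := ((hsel _).1 l hs).1
      have h4 : M.rateEst ω k l ≤ α * M.tot ω k l := by
        -- Selection forces at least `e⁻⁴ K` hits, so the random denominator can be replaced by a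
        -- constant and the estimate becomes linear in the values.
        unfold rateEst
        refine mul_le_mul_of_nonneg_right ?_ (M.tot_nonneg ω k l)
        have h5 : 0 < Real.exp (-4) * K := by positivity
        rw [hα, div_mul_eq_div_div, mul_div_assoc]
        rw [div_eq_mul_inv ((1 - M.q l) / M.q l)]
        refine mul_le_mul_of_nonneg_left ?_ (div_nonneg (by linarith) hq.le)
        calc (M.cnt ω k l : ℝ)⁻¹ ≤ (Real.exp (-4) * K)⁻¹ := inv_anti₀ h5 h3
          _ = _ := by rw [mul_inv, ← Real.exp_neg, neg_neg]; rfl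
      rw [← Finset.sum_mul]
      change _ ≤ α * (M.tot ω k l * _) + _
      have h6 : α * M.tot ω k l ≤ α * M.tot ω k l * ∏ r, g (ω (k, l', r)) :=
        le_mul_of_one_le_right (mul_nonneg hα0 (M.tot_nonneg ω k l)) h2
      have h7 := le_mul_of_one_le_right (M.w_nonneg k) h2
      linarith
    · rw [← Finset.sum_mul]
      exact add_nonneg (mul_nonneg hα0 (mul_nonneg (M.tot_nonneg ω k l) hP))
        (mul_nonneg (M.w_nonneg k) hP)
  refine (expect_mono M.laws_nonneg h1).trans ?_
  rw [expect_add, expect_const_mul, expect_const_mul, expect_sum, expect_prod_calls]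
  have hG0 : 0 ≤ ∑ a, M.law k l' a * g a :=
    Finset.sum_nonneg fun a _ => mul_nonneg (M.law_nonneg _ _ _) (hg a)
  have hGγ := pow_le_pow_left₀ hG0 hγ K
  have h8 : ∑ r₀ : Fin K, expect (M.laws K)
      (fun ω => M.val k (ω (k, l, r₀)) * ∏ r, g (ω (k, l', r))) ≤ K * (M.mean k l * γ ^ K) := by
    calc _ ≤ ∑ r₀ : Fin K, M.mean k l * γ ^ K := by
          refine Finset.sum_le_sum fun r₀ _ => ?_
          exact (M.expect_val_mul_prod_calls_le k l l' r₀ hg hc).trans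
            (mul_le_mul_of_nonneg_left hGγ (M.mean_nonneg k l))
      _ = _ := by simp
  have h9 : α * (K * (M.mean k l * γ ^ K)) = Real.exp 4 * (M.p k l * M.w k) * γ ^ K := by
    have := M.mean_eq k l
    rw [hα]
    field_simp
    rw [this]
    ring
  have hγ0 : 0 ≤ γ ^ K := (pow_nonneg hG0 K).trans hGγ
  have h10 : M.p k l * M.w k ≤ M.w k := mul_le_of_le_one_left (M.w_nonneg k) (M.p_le_one k l)
  have h11 : 0 ≤ M.p k l * M.w k := mul_nonneg (M.p_nonneg k l) (M.w_nonneg k)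
  -- The constant `56` of the conclusion is `55 > e⁴` for the estimate plus `1` for the target.
  have h12 : Real.exp 4 * (M.p k l * M.w k) ≤ 55 * M.w k :=
    mul_le_mul exp_four_lt.le h10 h11 (by norm_num)
  have h13 := mul_le_mul_of_nonneg_left h8 hα0
  have h14 := mul_le_mul_of_nonneg_right h12 hγ0
  have h15 := mul_le_mul_of_nonneg_left hGγ (M.w_nonneg k)
  linarith

end CallModel

/-! ### Rate weights, and the selection of unsuitable rates. -/

/-- A weight for the rate `q` that is of constant order for `1 / x ≤ q ≤ 1 / n` and decays
geometrically outside of this range. -/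
def rateWeight (x n q : ℝ) : ℝ := (4 * x - n) * q / ((4 * x * q + 2) * (n * q + 1))

/-- Uses `4x - n ≥ 2x`. The form of `rateWeight` is made for telescoping; this bound is the simpler
form in which it is compared with probabilities. -/
theorem le_rateWeight_of_mul_le {x n q b : ℝ} (hn : 0 ≤ n) (hxn : n ≤ 2 * x) (hx : 0 < x)
    (hq : 0 < q) (hb : 0 ≤ b) (h : n * q ≤ b) :
    x * q / ((2 * x * q + 1) * (b + 1)) ≤ rateWeight x n q := by
  unfold rateWeight
  have hnq : 0 ≤ n * q := by positivity
  have hxq : 0 < x * q := by positivity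
  rw [div_le_div_iff₀ (by nlinarith) (by nlinarith)]
  have h1 : n * q ≤ 2 * (x * q) := by nlinarith
  have h2 : 2 * (x * q) * (n * q + 1) ≤ (4 * x - n) * q * (b + 1) :=
    mul_le_mul (by linarith) (by linarith) (by linarith) (by linarith)
  nlinarith [mul_le_mul_of_nonneg_left h2 (by linarith : 0 ≤ 2 * (x * q) + 1)]

namespace CallModel

variable {κ R L : Type*} [Fintype L] (M : CallModel κ R L) {K : ℕ}

/-- The facts about the scale `k` that the analysis uses; `x` bounds the mean number of
mismatches, and `n` is a lower bound on the number of mismatches. -/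
structure IsActive (k : κ) (x n : ℝ) : Prop where
  one_le : 1 ≤ n
  le_two_mul : n ≤ 2 * x
  p_le : ∀ l, M.p k l ≤ Real.exp (-(n * M.q l))
  one_sub_p_le : ∀ l, 1 - M.p k l ≤ x * M.q l
  p_half : ∀ l, M.q l = 1 / 2 → M.p k l ≤ 1 / 2
  double : ∀ l, M.q l ≠ 1 / 2 → ∃ l', M.q l' = 2 * M.q l ∧ 1 - M.p k l' ≤ 3 * (1 - M.p k l)
  exists_p : ∃ l, 1 / 16 ≤ M.p k l

/-- The rates at which neither hits nor their absence are very unlikely. -/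
def IsMedium (n : ℝ) (k : κ) (l : R) : Prop := 1 / 48 ≤ 1 - M.p k l ∧ n * M.q l < 256

variable {M} {k : κ} {x n : ℝ}

theorem IsActive.pos (h : M.IsActive k x n) : 0 < x := by
  have := h.one_le
  have := h.le_two_mul
  linarith

theorem IsActive.rateWeight_nonneg (h : M.IsActive k x n) (l : R) :
    0 ≤ rateWeight x n (M.q l) := by
  have h1 := h.one_le
  have h2 := h.le_two_mul
  have h3 := M.q_pos l
  have h4 := h.pos
  unfold rateWeight
  exact div_nonneg (mul_nonneg (by linarith) h3.le) (by positivity)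

theorem IsActive.one_le_of_isMedium (h : M.IsActive k x n) {l : R} (hl : M.IsMedium n k l) :
    1 ≤ 12850 * rateWeight x n (M.q l) := by
  have h1 := h.one_le
  have h3 := M.q_pos l
  have h4 := h.pos
  have h5 := h.one_sub_p_le l
  have h6 := le_rateWeight_of_mul_le (by linarith) h.le_two_mul h4 h3 (by norm_num) hl.2.le
  have h7 : 1 / 48 ≤ x * M.q l := hl.1.trans h5
  -- The right side increases with `x q`, and `x q = 1/48` gives `1 / (50 · 257) = 1 / 12850`.
  have h8 : 1 / 12850 ≤ x * M.q l / ((2 * x * M.q l + 1) * (256 + 1)) := by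
    rw [div_le_div_iff₀ (by norm_num) (by nlinarith)]
    linarith
  linarith

open Classical in
/-- The estimate plus the target, if the selected rate is not medium. -/
def damage (M : CallModel κ R L) (n : ℝ) (sel : (R → ℕ) → Option R) (ω : κ × R × Fin K → L)
    (k : κ) : ℝ :=
  if ∃ l, sel (M.cnt ω k) = some l ∧ M.IsMedium n k l then 0 else M.est sel ω k + M.w k

theorem damage_nonneg (sel : (R → ℕ) → Option R) (ω : κ × R × Fin K → L) (k : κ) :
    0 ≤ M.damage n sel ω k := by
  unfold damage
  split_ifs
  exacts [le_rfl, add_nonneg (M.est_nonneg sel ω k) (M.w_nonneg k)]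

variable [Fintype κ] [Fintype R] [DecidableEq κ] [DecidableEq R]

/-- Rates at which almost all calls are hits are unlikely to be selected, since the doubled rate
would be better. -/
theorem IsActive.expect_selected_high_le (h : M.IsActive k x n) {sel : (R → ℕ) → Option R}
    (hsel : M.IsRule K sel) (hK : 2 ≤ K) (l : R) (hl : 1 - M.p k l < 1 / 48) :
    expect (M.laws K) (fun ω => if sel (M.cnt ω k) = some l then M.rateEst ω k l + M.w k else 0) ≤
      50000 * Real.exp (-(K / 2)) * (M.w k * rateWeight x n (M.q l)) := by
  have h1 := h.one_le
  have h3 := M.q_pos l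
  have h4 := h.pos
  have hne : M.q l ≠ 1 / 2 := by
    intro he
    have := h.p_half l he
    linarith
  obtain ⟨l', hq', hp'⟩ := h.double l hne
  have hll : l' ≠ l := by
    rintro rfl
    linarith
  -- The failure bound must retain a factor of order `min(1, x q)` in order to be summable over
  -- small rates; `η` carries it.
  set η := min (1 / 48) (x * M.q l) with hη
  have hη0 : 0 < η := lt_min (by norm_num) (by positivity)
  have hpη : 1 - M.p k l ≤ η := le_min hl.le (h.one_sub_p_le l)
  -- Chosen so that the two halves of the moment balance: the doubled rate misses with probability
  -- at most `3η = σ²/4`, and `(σ²/4)(2/σ) + σ/2 = σ`.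
  set σ := Real.sqrt (12 * η) with hσ
  have hσ2 : σ ^ 2 = 12 * η := Real.sq_sqrt (by positivity)
  have hσ0 : 0 < σ := Real.sqrt_pos.2 (by positivity)
  have hσ1 : σ ≤ 1 / 2 := by
    have : η ≤ 1 / 48 := min_le_left _ _
    nlinarith
  set b := Real.log (2 / σ) with hb
  have hb0 : 0 ≤ b := Real.log_nonneg (by rw [le_div_iff₀ hσ0]; linarith)
  have heb : Real.exp b = 2 / σ := Real.exp_log (by positivity)
  set g : L → ℝ := fun a => Real.exp (b * (1 - 2 * M.ind a)) with hg
  have hg1 : ∀ a, g a = 2 / σ + (σ / 2 - 2 / σ) * M.ind a := by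
    intro a
    simp only [hg, ind]
    split_ifs
    · rw [show b * (1 - 2 * 1) = -b by ring, Real.exp_neg, heb]
      field_simp
      ring
    · simp [heb]
  have hγ : ∑ a, M.law k l' a * g a ≤ σ := by
    simp only [hg1]
    rw [M.sum_law_mul_affine_ind]
    have h5 : 1 - M.p k l' ≤ σ ^ 2 / 4 := by
      rw [hσ2]
      linarith
    have h6 := M.p_le_one k l'
    calc _ = (1 - M.p k l') * (2 / σ) + M.p k l' * (σ / 2) := by ring
      _ ≤ σ ^ 2 / 4 * (2 / σ) + 1 * (σ / 2) := by gcongr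
      _ = σ := by
        field_simp
        ring
  -- If `l` wins, then at most half of the calls at the doubled rate are hits: either that rate
  -- misses the threshold, or `2q · cnt l' ≤ q · cnt l ≤ qK`.
  have hE : ∀ ω : κ × R × Fin K → L, sel (M.cnt ω k) = some l → 1 ≤ ∏ r, g (ω (k, l', r)) := by
    intro ω hs
    rw [← Real.exp_sum, Real.one_le_exp_iff, ← Finset.mul_sum, Finset.sum_sub_distrib,
      ← Finset.mul_sum, ← M.cast_cnt]
    refine mul_nonneg hb0 ?_
    simp only [Finset.sum_const, Finset.card_univ, Fintype.card_fin, nsmul_eq_mul, mul_one]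
    have hKp : (0 : ℝ) ≤ K := Nat.cast_nonneg K
    by_cases hc : Real.exp (-4) * K ≤ M.cnt ω k l'
    · have h5 := ((hsel _).1 l hs).2 l' hc
      have h6 := mul_le_mul_of_nonneg_left (M.cnt_le ω k l) h3.le
      rw [hq'] at h5
      have h7 : M.q l * (2 * M.cnt ω k l') ≤ M.q l * K := by linarith
      linarith [le_of_mul_le_mul_left h7 h3]
    · have := exp_neg_four_lt
      nlinarith
  have key := M.expect_selected_le hsel (by omega) k l l' (fun a => (Real.exp_pos _).le) hγ
    (fun he => absurd he hll) hE
  refine key.trans ?_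
  -- Two of the `K` factors `σ` are kept as `σ² = 12 η`, the others are bounded by `1/2`.
  have hσK : σ ^ K ≤ 48 * η * Real.exp (-(K / 2)) := by
    obtain ⟨j, rfl⟩ : ∃ j, K = 2 + j := ⟨K - 2, by omega⟩
    have h5 : σ ^ j ≤ (1 / 2) ^ j := pow_le_pow_left₀ hσ0.le hσ1 j
    have h6 : (1 / 2 : ℝ) ≤ Real.exp (-(1 / 2)) := by
      have := Real.add_one_le_exp (-(1 / 2) : ℝ)
      linarith
    have h7 : (1 / 2 : ℝ) ^ (2 + j) ≤ Real.exp (-(((2 + j : ℕ) : ℝ) / 2)) := by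
      calc (1 / 2 : ℝ) ^ (2 + j) ≤ Real.exp (-(1 / 2)) ^ (2 + j) :=
            pow_le_pow_left₀ (by norm_num) h6 _
        _ = _ := by
            rw [← Real.exp_nat_mul]
            congr 1
            ring
    calc σ ^ (2 + j) = 12 * η * σ ^ j := by rw [pow_add, hσ2]
      _ ≤ 12 * η * (1 / 2) ^ j := by gcongr
      _ = 48 * η * (1 / 2) ^ (2 + j) := by
          rw [pow_add]
          ring
      _ ≤ _ := by gcongr
  have hnq : n * M.q l ≤ 1 := by
    have h5 := h.p_le l
    have h6 := Real.add_one_le_exp (n * M.q l)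
    rw [Real.exp_neg] at h5
    have h7 : Real.exp (n * M.q l) * M.p k l ≤ 1 := by
      calc _ ≤ Real.exp (n * M.q l) * (Real.exp (n * M.q l))⁻¹ := by gcongr
        _ = 1 := mul_inv_cancel₀ (Real.exp_pos _).ne'
    nlinarith [M.p_nonneg k l]
  have hηz : η ≤ 6 * rateWeight x n (M.q l) := by
    have h5 := le_rateWeight_of_mul_le (by linarith) h.le_two_mul h4 h3 (by norm_num) hnq
    have hy : 0 < x * M.q l := by positivity
    have h6 : η ≤ 6 * (x * M.q l / ((2 * x * M.q l + 1) * (1 + 1))) := by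
      rw [← mul_div_assoc, le_div_iff₀ (by nlinarith)]
      rcases le_total (x * M.q l) 1 with hc | hc
      · have : η ≤ x * M.q l := min_le_right _ _
        nlinarith
      · have : η ≤ 1 / 48 := min_le_left _ _
        nlinarith
    linarith
  have hw := M.w_nonneg k
  have he := Real.exp_pos (-((K : ℝ) / 2))
  have hz := h.rateWeight_nonneg l
  calc 56 * M.w k * σ ^ K ≤ 56 * M.w k * (48 * (6 * rateWeight x n (M.q l)) *
        Real.exp (-(K / 2))) := by
        refine mul_le_mul_of_nonneg_left (hσK.trans ?_) (by positivity)
        gcongr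
    _ = 16128 * (Real.exp (-(K / 2)) * (M.w k * rateWeight x n (M.q l))) := by ring
    _ ≤ 50000 * (Real.exp (-(K / 2)) * (M.w k * rateWeight x n (M.q l))) := by
        gcongr
        norm_num
    _ = _ := by ring

/-- Rates at which hits are very unlikely are unlikely to be selected. -/
theorem IsActive.expect_selected_low_le (h : M.IsActive k x n) {sel : (R → ℕ) → Option R}
    (hsel : M.IsRule K sel) (hK : 2 ≤ K) (l : R) (hl : 256 ≤ n * M.q l) :
    expect (M.laws K) (fun ω => if sel (M.cnt ω k) = some l then M.rateEst ω k l + M.w k else 0) ≤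
      50000 * Real.exp (-(K / 2)) * (M.w k * rateWeight x n (M.q l)) := by
  have h1 := h.one_le
  have h3 := M.q_pos l
  have h4 := h.pos
  -- The tilt `v` is matched to `p ≤ e^(-v)`: then `p e^v ≤ 1`, and the moment of `g` is at most `2
  -- e^(-v e⁻⁴)`.
  set v := n * M.q l with hv
  have hK1 : (1 : ℝ) ≤ K := by exact_mod_cast (by omega : 1 ≤ K)
  set g : L → ℝ := fun a => Real.exp (v * (M.ind a - Real.exp (-4))) with hg
  set e := Real.exp (-(v * Real.exp (-4))) with he
  have hg1 : ∀ a, g a = e + (e * (Real.exp v - 1)) * M.ind a := by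
    intro a
    simp only [hg, ind, he]
    split_ifs
    · rw [show v * (1 - Real.exp (-4)) = -(v * Real.exp (-4)) + v by ring, Real.exp_add]
      ring
    · simp
  have hev : 1 ≤ Real.exp v := Real.one_le_exp (by linarith)
  have he0 : 0 < e := Real.exp_pos _
  have hsum : ∑ a, M.law k l a * g a = e + (e * (Real.exp v - 1)) * M.p k l := by
    simp only [hg1]
    rw [M.sum_law_mul_affine_ind]
  have hesum : e ≤ ∑ a, M.law k l a * g a := by
    rw [hsum]
    have := mul_nonneg (mul_nonneg he0.le (sub_nonneg.2 hev)) (M.p_nonneg k l)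
    linarith
  have hγ : ∑ a, M.law k l a * g a ≤ Real.exp (-1) * Real.exp (-(v / 110)) := by
    have h5 : M.p k l * Real.exp v ≤ 1 := by
      calc _ ≤ Real.exp (-v) * Real.exp v :=
            mul_le_mul_of_nonneg_right (h.p_le l) (Real.exp_pos _).le
        _ = 1 := by rw [← Real.exp_add]; simp
    have h6 : e + (e * (Real.exp v - 1)) * M.p k l ≤ 2 * e := by
      nlinarith [M.p_nonneg k l]
    have h7 : e ≤ Real.exp (-2) * Real.exp (-(v / 110)) := by
      rw [← Real.exp_add]
      refine Real.exp_le_exp.2 ?_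
      have := lt_exp_neg_four
      nlinarith
    have h8 : 2 * Real.exp (-2) ≤ Real.exp (-1) := by
      rw [show (-2 : ℝ) = -1 + -1 by norm_num, Real.exp_add]
      have h9 := Real.add_one_le_exp (1 : ℝ)
      have h10 : Real.exp (-1) * Real.exp 1 = 1 := by rw [← Real.exp_add]; simp
      nlinarith [Real.exp_pos (-1)]
    rw [hsum]
    nlinarith [Real.exp_pos (-(v / 110))]
  have hE : ∀ ω : κ × R × Fin K → L, sel (M.cnt ω k) = some l → 1 ≤ ∏ r, g (ω (k, l, r)) := by
    intro ω hs
    have := ((hsel _).1 l hs).1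
    rw [← Real.exp_sum, Real.one_le_exp_iff, ← Finset.mul_sum, Finset.sum_sub_distrib,
      ← M.cast_cnt]
    refine mul_nonneg (by linarith) ?_
    simp only [Finset.sum_const, Finset.card_univ, Fintype.card_fin, nsmul_eq_mul]
    linarith
  -- Negative correlation: the value vanishes on hits, and off hits `g` takes its smaller value `e`,
  -- which is at most its mean.
  have hc : ∑ a, M.law k l a * (M.val k a * g a) ≤ M.mean k l * ∑ a, M.law k l a * g a := by
    calc _ = M.mean k l * e := by
          unfold mean
          rw [Finset.sum_mul]
          refine Finset.sum_congr rfl fun a _ => ?_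
          rw [hg1]
          cases ha : M.hit a
          · simp [ind, ha]
            ring
          · simp [M.val_hit k a ha]
      _ ≤ _ := mul_le_mul_of_nonneg_left hesum (M.mean_nonneg k l)
  have key := M.expect_selected_le hsel (by omega) k l l (fun a => (Real.exp_pos _).le) hγ
    (fun _ => hc) hE
  refine key.trans ?_
  -- One factor `e^(-v/110)` is spent on `110 / v`, the decay that makes the bound summable over
  -- large rates.
  have hpow : (Real.exp (-1) * Real.exp (-(v / 110))) ^ K ≤ Real.exp (-(K / 2)) * (110 / v) := by
    rw [mul_pow, ← Real.exp_nat_mul, ← Real.exp_nat_mul]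
    refine mul_le_mul (Real.exp_le_exp.2 (by linarith)) ?_ (Real.exp_pos _).le
      (Real.exp_pos _).le
    have h5 : Real.exp (K * -(v / 110)) ≤ Real.exp (-(v / 110)) :=
      Real.exp_le_exp.2 (by nlinarith)
    refine h5.trans ?_
    rw [Real.exp_neg, ← one_div, div_le_div_iff₀ (Real.exp_pos _) (by linarith)]
    have := Real.add_one_le_exp (v / 110)
    linarith
  have hvz : 1 / v ≤ 8 * rateWeight x n (M.q l) := by
    have h5 := le_rateWeight_of_mul_le (by linarith) h.le_two_mul h4 h3 (by linarith)
      (le_refl v)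
    have h6 : v ≤ 2 * (x * M.q l) := by
      rw [hv, ← mul_assoc]
      exact mul_le_mul_of_nonneg_right h.le_two_mul h3.le
    have h7 : 1 / v ≤ 8 * (x * M.q l / ((2 * x * M.q l + 1) * (v + 1))) := by
      rw [← mul_div_assoc, div_le_div_iff₀ (by linarith) (by nlinarith)]
      nlinarith
    linarith
  have hw := M.w_nonneg k
  have he := Real.exp_pos (-((K : ℝ) / 2))
  calc _ ≤ 56 * M.w k * (Real.exp (-(K / 2)) * (110 * (1 / v))) := by
        rw [mul_one_div]
        exact mul_le_mul_of_nonneg_left hpow (by positivity)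
    _ ≤ 56 * M.w k * (Real.exp (-(K / 2)) * (110 * (8 * rateWeight x n (M.q l)))) := by gcongr
    _ = 49280 * (Real.exp (-(K / 2)) * (M.w k * rateWeight x n (M.q l))) := by ring
    _ ≤ 50000 * (Real.exp (-(K / 2)) * (M.w k * rateWeight x n (M.q l))) := by
        refine mul_le_mul_of_nonneg_right (by norm_num) ?_
        exact mul_nonneg he.le (mul_nonneg hw (h.rateWeight_nonneg l))
    _ = _ := by ring

theorem IsActive.prob_none_le (h : M.IsActive k x n) {sel : (R → ℕ) → Option R}
    (hsel : M.IsRule K sel) :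
    prob (M.laws K) {ω | sel (M.cnt ω k) = none} ≤ 2 * Real.exp (-(K / 2500)) := by
  obtain ⟨l, hl⟩ := h.exists_p
  -- The gap between the hit probability `1/16` and the threshold `e⁻⁴ < 1/54` exceeds `1/25`.
  have h1 := M.prob_cnt_deviation_le (K := K) k l (δ := 1 / 25) (by norm_num) (by norm_num)
  rw [show (K : ℝ) * (1 / 25) ^ 2 / 4 = K / 2500 by ring] at h1
  refine (prob_mono M.laws_nonneg fun ω hω => ?_).trans h1
  have h2 := not_le.1 ((hsel _).2 hω l)
  have hKp : (0 : ℝ) ≤ K := Nat.cast_nonneg K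
  have h3 := exp_neg_four_lt
  rw [Set.mem_ofPred_eq, abs_sub_comm]
  refine le_trans ?_ (le_abs_self _)
  nlinarith

theorem IsActive.expect_damage_le (h : M.IsActive k x n) {sel : (R → ℕ) → Option R}
    (hsel : M.IsRule K sel) (hK : 2 ≤ K) :
    expect (M.laws K) (fun ω => M.damage n sel ω k) ≤
      50000 * Real.exp (-(K / 2500)) * (M.w k * (1 + ∑ l, rateWeight x n (M.q l))) := by
  classical
  have hw := M.w_nonneg k
  have h1 : ∀ ω : κ × R × Fin K → L, M.damage n sel ω k ≤
      M.w k * ({ω | sel (M.cnt ω k) = none}.indicator (fun _ => 1) ω) +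
      ∑ l ∈ Finset.univ.filter (fun l => ¬ M.IsMedium n k l),
        (if sel (M.cnt ω k) = some l then M.rateEst ω k l + M.w k else 0) := by
    intro ω
    have hs0 : 0 ≤ ∑ l ∈ Finset.univ.filter (fun l => ¬ M.IsMedium n k l),
        (if sel (M.cnt ω k) = some l then M.rateEst ω k l + M.w k else 0) :=
      Finset.sum_nonneg fun l _ => by
        split_ifs
        exacts [add_nonneg (M.rateEst_nonneg ω k l) hw, le_rfl]
    unfold damage
    split_ifs with hc
    · refine add_nonneg (mul_nonneg hw (Set.indicator_nonneg (fun _ _ => zero_le_one) _)) hs0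
    · unfold est
      cases hs : sel (M.cnt ω k) with
      | none => simp [hs]
      | some l =>
        have hl : ¬ M.IsMedium n k l := fun hl => hc ⟨l, hs, hl⟩
        simp [hs, hl]
  refine (expect_mono M.laws_nonneg h1).trans ?_
  rw [expect_add, expect_const_mul, expect_sum]
  have hexp : Real.exp (-((K : ℝ) / 2)) ≤ Real.exp (-(K / 2500)) :=
    Real.exp_le_exp.2 (by linarith [Nat.cast_nonneg (α := ℝ) K])
  have h2 : ∑ l ∈ Finset.univ.filter (fun l => ¬ M.IsMedium n k l), expect (M.laws K)
      (fun ω => if sel (M.cnt ω k) = some l then M.rateEst ω k l + M.w k else 0) ≤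
      ∑ l, 50000 * Real.exp (-(K / 2500)) * (M.w k * rateWeight x n (M.q l)) := by
    have hz := fun l => mul_nonneg hw (h.rateWeight_nonneg l)
    refine (Finset.sum_le_sum (g := fun l => 50000 * Real.exp (-(K / 2500)) *
      (M.w k * rateWeight x n (M.q l))) fun l hl => ?_).trans
      (Finset.sum_le_univ_sum_of_nonneg fun l => mul_nonneg (by positivity) (hz l))
    have h3 : 50000 * Real.exp (-((K : ℝ) / 2)) * (M.w k * rateWeight x n (M.q l)) ≤
        50000 * Real.exp (-(K / 2500)) * (M.w k * rateWeight x n (M.q l)) :=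
      mul_le_mul_of_nonneg_right (by linarith) (hz l)
    refine le_trans ?_ h3
    have hl' : ¬ M.IsMedium n k l := (Finset.mem_filter.1 hl).2
    unfold IsMedium at hl'
    rcases lt_or_ge (1 - M.p k l) (1 / 48) with hp | hp
    · exact h.expect_selected_high_le hsel hK l hp
    · exact h.expect_selected_low_le hsel hK l (not_lt.1 fun hn => hl' ⟨hp, hn⟩)
  have h4 := mul_le_mul_of_nonneg_left (h.prob_none_le hsel (K := K)) hw
  unfold prob at h4
  rw [← Finset.mul_sum, ← Finset.mul_sum] at h2
  have h5 : 0 ≤ M.w k * Real.exp (-((K : ℝ) / 2500)) := mul_nonneg hw (Real.exp_pos _).le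
  nlinarith

end CallModel

/-! ### Bias and fluctuation at the medium rates. -/

namespace CallModel

variable {κ R L : Type*} [Fintype L] (M : CallModel κ R L) {K : ℕ}

/-- The conditional mean, given all hits, of the estimate at a scale and a rate. -/
def condEst (ω : κ × R × Fin K → L) (k : κ) (l : R) : ℝ :=
  (1 - M.q l) / (M.q l * M.cnt ω k l) * (M.condMean k l * (K - M.cnt ω k l))

theorem condEst_nonneg (ω : κ × R × Fin K → L) (k : κ) (l : R) : 0 ≤ M.condEst ω k l := by
  have h1 := M.q_pos l
  have h2 := M.q_le l
  exact mul_nonneg (div_nonneg (by linarith) (by positivity))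
    (mul_nonneg (M.condMean_nonneg k l) (sub_nonneg.2 (M.cnt_le ω k l)))

/-- By the mean identity, the conditional mean given `N` hits is `w · p(K-N) / ((1-p)N)`, with
relative error `(pK-N) / ((1-p)N)`. A medium rate has `1 - p ≥ 1/48`, the threshold gives `N ≥
K/55`, and `2640 = 48 · 55`. -/
theorem abs_condEst_sub_le (hK : 0 < K) {ω : κ × R × Fin K → L} {k : κ} {l : R} {n : ℝ}
    (hl : M.IsMedium n k l) (hc : Real.exp (-4) * K ≤ M.cnt ω k l) :
    |M.condEst ω k l - M.w k| ≤ M.w k * (2640 / K * |M.cnt ω k l - M.p k l * K|) := by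
  have hK' : (0 : ℝ) < K := by exact_mod_cast hK
  have hq := M.q_pos l
  have hp : 1 / 48 ≤ 1 - M.p k l := hl.1
  have hp0 : 0 < 1 - M.p k l := by linarith
  have hc1 : K / 55 ≤ (M.cnt ω k l : ℝ) := by
    have := lt_exp_neg_four
    nlinarith
  have hc0 : (0 : ℝ) < M.cnt ω k l := lt_of_lt_of_le (by positivity) hc1
  have hmean := M.mean_eq k l
  have h1 : M.condEst ω k l - M.w k =
      M.w k * ((M.p k l * K - M.cnt ω k l) / ((1 - M.p k l) * M.cnt ω k l)) := by
    have h2 : M.condEst ω k l = ((1 - M.q l) * M.mean k l) * (K - M.cnt ω k l) /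
        (M.q l * M.cnt ω k l * (1 - M.p k l)) := by
      unfold condEst condMean
      field_simp
    rw [h2, hmean]
    field_simp
    ring
  rw [h1, abs_mul, abs_of_nonneg (M.w_nonneg k), abs_div, abs_sub_comm,
    abs_of_pos (mul_pos hp0 hc0)]
  refine mul_le_mul_of_nonneg_left ?_ (M.w_nonneg k)
  rw [div_eq_inv_mul]
  refine mul_le_mul_of_nonneg_right ?_ (abs_nonneg _)
  rw [inv_le_comm₀ (mul_pos hp0 hc0) (by positivity), inv_div]
  calc (K : ℝ) / 2640 = 1 / 48 * (K / 55) := by ring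
    _ ≤ _ := mul_le_mul hp hc1 (by positivity) hp0.le

variable [Fintype R] (act : Finset κ) (x n : κ → ℝ) (sel : (R → ℕ) → Option R)

open Classical in
/-- The sum over the active scales whose selected rate is medium. -/
def medSum (F : κ → R → ℝ) (ω : κ × R × Fin K → L) : ℝ :=
  ∑ k ∈ act, ∑ l, if sel (M.cnt ω k) = some l ∧ M.IsMedium (n k) k l then F k l else 0

/-- The total weight of the active scales, with the number of relevant rates as a factor. -/
def totalWeight : ℝ := ∑ k ∈ act, M.w k * (1 + ∑ l, rateWeight (x k) (n k) (M.q l))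

open Classical in
/-- The deviations of the numbers of hits at the medium rates beyond a threshold. -/
def biasExcess (δ : ℝ) (ω : κ × R × Fin K → L) : ℝ :=
  ∑ k ∈ act, ∑ l, M.w k * ((2640 / K) * if M.IsMedium (n k) k l then
    (if δ * K ≤ |M.cnt ω k l - M.p k l * K| then |M.cnt ω k l - M.p k l * K| else 0) else 0)

variable {act x n sel}

theorem medSum_sub (F G : κ → R → ℝ) (ω : κ × R × Fin K → L) :
    M.medSum act n sel (fun k l => F k l - G k l) ω =
      M.medSum act n sel F ω - M.medSum act n sel G ω := by
  unfold medSum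
  rw [← Finset.sum_sub_distrib]
  refine Finset.sum_congr rfl fun k _ => ?_
  rw [← Finset.sum_sub_distrib]
  refine Finset.sum_congr rfl fun l _ => ?_
  split_ifs <;> simp

theorem medSum_const_mul (a : ℝ) (F : κ → R → ℝ) (ω : κ × R × Fin K → L) :
    M.medSum act n sel (fun k l => a * F k l) ω = a * M.medSum act n sel F ω := by
  unfold medSum
  rw [Finset.mul_sum]
  refine Finset.sum_congr rfl fun k _ => ?_
  rw [Finset.mul_sum]
  refine Finset.sum_congr rfl fun l _ => ?_
  split_ifs <;> simp

theorem sum_ite_selected_le {c : Option R} (P : R → Prop) [∀ l, Decidable (c = some l ∧ P l)]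
    {a : ℝ} (ha : 0 ≤ a) : (∑ l, if c = some l ∧ P l then a else 0) ≤ a := by
  classical
  cases c with
  | none => simpa using ha
  | some l₀ =>
    rw [Finset.sum_eq_single l₀]
    · split_ifs
      exacts [le_rfl, ha]
    · intro l _ hl
      simp [hl.symm]
    · simp

theorem medSum_w_le (ω : κ × R × Fin K → L) :
    M.medSum act n sel (fun k _ => M.w k) ω ≤ ∑ k ∈ act, M.w k := by
  classical
  exact Finset.sum_le_sum fun k _ => sum_ite_selected_le _ (M.w_nonneg k)

/-- Deviations of the count below `δ K` cost `2640 δ w`, once per scale since one rate is selected.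
Larger ones are charged to `biasExcess`, which sums over all medium rates and so does not involve
the selection. -/
theorem abs_medSum_condEst_sub_le (hK : 0 < K) (hsel : M.IsRule K sel) {δ : ℝ} (hδ : 0 ≤ δ)
    (ω : κ × R × Fin K → L) :
    |M.medSum act n sel (M.condEst ω) ω - M.medSum act n sel (fun k _ => M.w k) ω| ≤
      2640 * δ * ∑ k ∈ act, M.w k + M.biasExcess act n δ ω := by
  classical
  have hK' : (0 : ℝ) < K := by exact_mod_cast hK
  rw [← medSum_sub]
  unfold medSum biasExcess
  rw [Finset.mul_sum, ← Finset.sum_add_distrib]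
  refine (Finset.abs_sum_le_sum_abs _ _).trans (Finset.sum_le_sum fun k _ => ?_)
  refine (Finset.abs_sum_le_sum_abs _ _).trans ?_
  have hw := M.w_nonneg k
  refine le_trans (Finset.sum_le_sum (g := fun l =>
    (if sel (M.cnt ω k) = some l ∧ M.IsMedium (n k) k l then 2640 * δ * M.w k else 0) +
    M.w k * ((2640 / K) * if M.IsMedium (n k) k l then
    (if δ * K ≤ |M.cnt ω k l - M.p k l * K| then |M.cnt ω k l - M.p k l * K| else 0) else 0))
    fun l _ => ?_) ?_
  · split_ifs with h1 h2 h3 h4 h5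
    · have h6 := M.abs_condEst_sub_le hK h2 ((hsel _).1 l h1.1).1
      have : 0 ≤ 2640 * δ * M.w k := by positivity
      linarith
    · have h6 := M.abs_condEst_sub_le hK h2 ((hsel _).1 l h1.1).1
      refine h6.trans ?_
      rw [mul_zero, mul_zero, add_zero, mul_comm _ (M.w k)]
      refine mul_le_mul_of_nonneg_left ?_ hw
      rw [div_mul_eq_mul_div, div_le_iff₀ hK']
      nlinarith [not_le.1 h3]
    · exact absurd h1.2 h2
    · rw [abs_zero, zero_add]
      positivity
    · simp
    · simp
  · rw [Finset.sum_add_distrib]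
    exact add_le_add_left (sum_ite_selected_le _ (by positivity)) _

/-- At a scale with a medium selection both differences cancel exactly; at any other scale `medSum`
has no term and `damage` dominates `|est - w|`. -/
theorem abs_sum_est_sub_le (ω : κ × R × Fin K → L) :
    |(∑ k ∈ act, M.est sel ω k - M.medSum act n sel (M.rateEst ω) ω) -
      (∑ k ∈ act, M.w k - M.medSum act n sel (fun k _ => M.w k) ω)| ≤
      ∑ k ∈ act, M.damage (n k) sel ω k := by
  classical
  unfold medSum
  rw [← Finset.sum_sub_distrib, ← Finset.sum_sub_distrib, ← Finset.sum_sub_distrib]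
  refine (Finset.abs_sum_le_sum_abs _ _).trans (Finset.sum_le_sum fun k _ => ?_)
  unfold damage
  split_ifs with h
  · obtain ⟨l, hs, hl⟩ := h
    rw [Finset.sum_eq_single l, Finset.sum_eq_single l]
    · simp [hs, hl, est]
    · intro l' _ hl'
      simp [hs, hl'.symm]
    · simp
    · intro l' _ hl'
      simp [hs, hl'.symm]
    · simp
  · rw [Finset.sum_eq_zero, Finset.sum_eq_zero]
    · have h1 := M.est_nonneg sel ω k
      have h2 := M.w_nonneg k
      rw [sub_zero, sub_zero, abs_le]
      constructor <;> linarith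
    · intro l _
      exact if_neg fun hl => h ⟨l, hl⟩
    · intro l _
      exact if_neg fun hl => h ⟨l, hl⟩

variable [Fintype κ] [DecidableEq κ] [DecidableEq R]

/-- Each medium rate has weight at least `1/12850`, so the weights count the medium rates; `67848000
= 5280 · 12850`. -/
theorem expect_biasExcess_le (hact : ∀ k ∈ act, M.IsActive k (x k) (n k)) {δ : ℝ} (h0 : 0 < δ)
    (h2 : δ ≤ 2) (hK : 2 ≤ K * δ ^ 2) :
    expect (M.laws K) (M.biasExcess act n δ) ≤
      67848000 * δ * Real.exp (-(K * δ ^ 2 / 4)) * M.totalWeight act x n := by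
  classical
  have hK0 : (0 : ℝ) < K := by
    by_contra h
    have : (K : ℝ) = 0 := le_antisymm (not_lt.1 h) (Nat.cast_nonneg K)
    rw [this] at hK
    norm_num at hK
  set E := Real.exp (-(K * δ ^ 2 / 4)) with hE
  have hE0 : 0 < E := Real.exp_pos _
  change expect (M.laws K) (fun ω => ∑ k ∈ act, ∑ l, _) ≤ _
  rw [expect_sum, totalWeight, Finset.mul_sum]
  refine Finset.sum_le_sum fun k hk => ?_
  have hw := M.w_nonneg k
  rw [expect_sum]
  have h3 : ∀ l, expect (M.laws K) (fun ω => M.w k * ((2640 / K) *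
      if M.IsMedium (n k) k l then (if δ * K ≤ |M.cnt ω k l - M.p k l * K| then
        |M.cnt ω k l - M.p k l * K| else 0) else 0)) ≤
      67848000 * δ * E * M.w k * rateWeight (x k) (n k) (M.q l) := by
    intro l
    have hz := (hact k hk).rateWeight_nonneg l
    rw [expect_const_mul, expect_const_mul]
    by_cases hl : M.IsMedium (n k) k l
    · simp only [hl, if_true]
      have h4 := M.expect_cnt_excess_le k l h0 h2 hK
      have h5 := (hact k hk).one_le_of_isMedium hl
      have h6 : M.w k * (2640 / K * (2 * (δ * K) * E)) = 5280 * δ * E * M.w k := by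
        field_simp
        ring
      have h7 : 0 ≤ 5280 * δ * E * M.w k := by positivity
      have h8 := mul_le_mul_of_nonneg_left
        (mul_le_mul_of_nonneg_left h4 (by positivity : (0 : ℝ) ≤ 2640 / K)) hw
      rw [h6] at h8
      refine h8.trans ((le_mul_of_one_le_right h7 h5).trans_eq (by ring))
    · simp only [hl, if_false]
      have : expect (M.laws K) (fun _ => (0 : ℝ)) = 0 := by simp [expect]
      rw [this, mul_zero, mul_zero]
      positivity
  refine (Finset.sum_le_sum fun l _ => h3 l).trans ?_
  rw [← Finset.mul_sum, mul_assoc (67848000 * δ * E)]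
  refine mul_le_mul_of_nonneg_left (mul_le_mul_of_nonneg_left ?_ hw) (by positivity)
  linarith

/-- The exponential moment is applied with coefficient `τ (1-q)/(qN)` at each selected medium rate
and `0` elsewhere. There `x q ≥ 1/48` and `N ≥ K/55`, so one value changes the estimate by at most
`5280 D x / K = 5280 Q / K`, a bound common to all scales. -/
theorem prob_centred_le (hact : ∀ k ∈ act, M.IsActive k (x k) (n k)) (hsel : M.IsRule K sel)
    {Q : ℝ} (hQ : ∀ k ∈ act, M.D k * x k = Q) (τ b : ℝ) (hK : 0 < K)
    (hτ : 5280 * |τ| * Q ≤ K) :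
    prob (M.laws K) {ω | b ≤ τ * (M.medSum act n sel (M.rateEst ω) ω -
      M.medSum act n sel (M.condEst ω) ω) -
      τ ^ 2 * (5280 * Q / K) * M.medSum act n sel (M.condEst ω) ω} ≤ Real.exp (-b) := by
  classical
  have hK' : (0 : ℝ) < K := by exact_mod_cast hK
  set s : (κ → R → ℕ) → κ → R → ℝ := fun N k l =>
    if k ∈ act ∧ sel (N k) = some l ∧ M.IsMedium (n k) k l then
      τ * ((1 - M.q l) / (M.q l * N k l)) else 0 with hs
  have hodds : ∀ N : κ → R → ℕ, ∀ k l, k ∈ act → sel (N k) = some l → M.IsMedium (n k) k l →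
      0 ≤ (1 - M.q l) / (M.q l * N k l) ∧
      (1 - M.q l) / (M.q l * N k l) * (2 * M.D k) ≤ 5280 * Q / K := by
    intro N k l hk hsl hl
    have hq := M.q_pos l
    have hq2 := M.q_le l
    have hD := M.D_pos k
    have h1 := ((hsel _).1 l hsl).1
    have h2 : 1 / 48 ≤ x k * M.q l := hl.1.trans ((hact k hk).one_sub_p_le l)
    have hN : K / 55 ≤ (N k l : ℝ) := by
      have := lt_exp_neg_four
      nlinarith
    have hN0 : (0 : ℝ) < N k l := lt_of_lt_of_le (by positivity) hN
    refine ⟨div_nonneg (by linarith) (by positivity), ?_⟩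
    rw [← hQ k hk, div_mul_eq_mul_div, div_le_div_iff₀ (by positivity) hK']
    have h3 : K / 2640 ≤ x k * (M.q l * N k l) := by
      calc K / 2640 = 1 / 48 * ((K : ℝ) / 55) := by ring
        _ ≤ x k * M.q l * N k l := mul_le_mul h2 hN (by positivity) (by linarith)
        _ = _ := by ring
    have h4 := mul_le_mul_of_nonneg_left h3 (by positivity : 0 ≤ 5280 * M.D k)
    have h5 : (1 - M.q l) * (2 * M.D k * K) ≤ 1 * (2 * M.D k * K) :=
      mul_le_mul_of_nonneg_right (by linarith) (by positivity)
    linarith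
  have h1 : ∀ N k l, |s N k l| * (2 * M.D k) ≤ 1 := by
    intro N k l
    simp only [hs]
    split_ifs with hc
    · obtain ⟨ha, hb⟩ := hodds N k l hc.1 hc.2.1 hc.2.2
      rw [abs_mul, abs_of_nonneg ha, mul_assoc]
      refine (mul_le_mul_of_nonneg_left hb (abs_nonneg τ)).trans ?_
      rw [← mul_div_assoc, div_le_one hK']
      linarith
    · simp
  have h2 : ∀ N k l, s N k l ≠ 0 → M.p k l < 1 := by
    intro N k l h
    simp only [hs, ne_eq, ite_eq_right_iff, not_forall] at h
    obtain ⟨hc, -⟩ := h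
    have := hc.2.2.1
    linarith
  have key := M.expect_exp_centred_le_one (K := K) s h1 h2
  have h3 := prob_le_expect_div (M.laws_nonneg (K := K)) (Real.exp_pos b)
    (E := {ω | b ≤ τ * (M.medSum act n sel (M.rateEst ω) ω -
      M.medSum act n sel (M.condEst ω) ω) -
      τ ^ 2 * (5280 * Q / K) * M.medSum act n sel (M.condEst ω) ω})
    (fun ω => (Real.exp_pos _).le) (fun ω hω => Real.exp_le_exp.2 (le_trans hω ?_))
    (F := fun ω => Real.exp (∑ k, ∑ l,
      (s (M.cnt ω) k l * (M.tot ω k l - M.condMean k l * (K - M.cnt ω k l)) -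
        s (M.cnt ω) k l ^ 2 * (2 * M.D k) * (M.condMean k l * (K - M.cnt ω k l)))))
  · refine h3.trans ?_
    rw [Real.exp_neg, div_eq_mul_inv]
    exact mul_le_of_le_one_left (inv_nonneg.2 (Real.exp_pos _).le) key
  · rw [← medSum_sub, ← medSum_const_mul, ← medSum_const_mul, ← medSum_sub]
    unfold medSum
    rw [← Finset.sum_subset (Finset.subset_univ act)]
    · refine Finset.sum_le_sum fun k hk => Finset.sum_le_sum fun l _ => ?_
      by_cases hc : sel (M.cnt ω k) = some l ∧ M.IsMedium (n k) k l
      · obtain ⟨ha, hb⟩ := hodds (M.cnt ω) k l hk hc.1 hc.2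
        have hce := M.condEst_nonneg ω k l
        simp only [hs, hk, hc, and_self, if_true]
        have e1 : (τ * ((1 - M.q l) / (M.q l * M.cnt ω k l))) ^ 2 * (2 * M.D k) *
            (M.condMean k l * (K - M.cnt ω k l)) =
            τ ^ 2 * ((1 - M.q l) / (M.q l * M.cnt ω k l) * (2 * M.D k)) * M.condEst ω k l := by
          unfold condEst
          ring
        have e2 : τ * ((1 - M.q l) / (M.q l * M.cnt ω k l)) *
            (M.tot ω k l - M.condMean k l * (K - M.cnt ω k l)) =
            τ * (M.rateEst ω k l - M.condEst ω k l) := by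
          unfold condEst rateEst
          ring
        rw [e1, e2]
        have := mul_le_mul_of_nonneg_right (mul_le_mul_of_nonneg_left hb (sq_nonneg τ)) hce
        linarith
      · simp [hs, hc]
    · intro k _ hk
      simp [hs, hk]

end CallModel

/-! ### The four error terms combined. -/

namespace CallModel

variable {κ R L : Type*} [Fintype L] (M : CallModel κ R L) {K : ℕ}
variable [Fintype R] {act : Finset κ} {x n : κ → ℝ} {sel : (R → ℕ) → Option R}

/-- Fluctuation, bias and damage are each at most `εS/10`, so the error is below `3εS/10`. The sum
of the estimates is then at least `7S/10`, which turns the error into one relative to the output.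
The exponent `θ = 60t/(εS)` is fixed by `3t = θ · εS/20`. -/
theorem abs_sum_est_sub_lt_of_good (hsel : M.IsRule K sel) {Q S ε t : ℝ}
    (hS : ∑ k ∈ act, M.w k = S) (hS0 : 0 < S) (hε0 : 0 < ε) (hε1 : ε ≤ 1) (ht : 0 < t)
    (hQ0 : 0 ≤ Q) (hK : 0 < K) (hKQ : 12672000 * (t * Q) ≤ K * ε ^ 2 * S)
    {ω : κ × R × Fin K → L}
    (h₁ : 60 * t / (ε * S) * (M.medSum act n sel (M.rateEst ω) ω -
      M.medSum act n sel (M.condEst ω) ω) -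
      (60 * t / (ε * S)) ^ 2 * (5280 * Q / K) * M.medSum act n sel (M.condEst ω) ω < 3 * t)
    (h₂ : -(60 * t / (ε * S)) * (M.medSum act n sel (M.rateEst ω) ω -
      M.medSum act n sel (M.condEst ω) ω) -
      (-(60 * t / (ε * S))) ^ 2 * (5280 * Q / K) * M.medSum act n sel (M.condEst ω) ω < 3 * t)
    (h₃ : M.biasExcess act n (ε / 52800) ω < ε * S / 20)
    (h₄ : ∑ k ∈ act, M.damage (n k) sel ω k < ε * S / 10) :
    |∑ k ∈ act, M.est sel ω k - S| < ε * ∑ k ∈ act, M.est sel ω k := by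
  have hK' : (0 : ℝ) < K := by exact_mod_cast hK
  have h5 := M.abs_medSum_condEst_sub_le (act := act) (n := n) hK hsel
    (δ := ε / 52800) (by positivity) ω
  have h6 := M.abs_sum_est_sub_le (act := act) (n := n) (sel := sel) ω
  have h7 := M.medSum_w_le (act := act) (n := n) (sel := sel) ω
  rw [hS] at h5 h6 h7
  set gE := M.medSum act n sel (M.rateEst ω) ω
  set gM := M.medSum act n sel (M.condEst ω) ω
  set gW := M.medSum act n sel (fun k _ => M.w k) ω
  set W := ∑ k ∈ act, M.est sel ω k
  set θ := 60 * t / (ε * S) with hθ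
  have hθ0 : 0 < θ := by positivity
  have hεS : ε * S ≤ S := mul_le_of_le_one_left hS0.le hε1
  obtain ⟨h5a, h5b⟩ := abs_le.1 h5
  obtain ⟨h6a, h6b⟩ := abs_le.1 h6
  have hgM : gM ≤ 2 * S := by linarith
  -- The second-order term; `12672000 = 60 · 5280 · 2 · 20`.
  have hc : θ * (5280 * Q / K) * gM ≤ ε * S / 20 := by
    calc θ * (5280 * Q / K) * gM ≤ θ * (5280 * Q / K) * (2 * S) :=
          mul_le_mul_of_nonneg_left hgM (by positivity)
      _ = 12672000 * (t * Q) / (20 * ε * K) := by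
          rw [hθ]
          field_simp
          ring
      _ ≤ K * ε ^ 2 * S / (20 * ε * K) := by gcongr
      _ = _ := by field_simp
  have hd : 3 * t = θ * (ε * S / 20) := by
    rw [hθ]
    field_simp
    ring
  have h8 : gE - gM < ε * S / 10 := by
    have e1 : θ * ((gE - gM) - θ * (5280 * Q / K) * gM) < θ * (ε * S / 20) := by
      rw [← hd]
      refine lt_of_eq_of_lt ?_ h₁
      ring
    linarith [lt_of_mul_lt_mul_left e1 hθ0.le]
  have h9 : -(gE - gM) < ε * S / 10 := by
    have e1 : θ * (-(gE - gM) - θ * (5280 * Q / K) * gM) < θ * (ε * S / 20) := by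
      rw [← hd]
      refine lt_of_eq_of_lt ?_ h₂
      ring
    linarith [lt_of_mul_lt_mul_left e1 hθ0.le]
  have hlow : 7 / 10 * S ≤ W := by linarith
  have hεW := mul_le_mul_of_nonneg_left hlow hε0.le
  have hpos : 0 < ε * S := mul_pos hε0 hS0
  rw [abs_lt]
  constructor <;> linarith

variable [Fintype κ] [DecidableEq κ] [DecidableEq R]

/-- The concentration of the sum of the estimates. -/
theorem prob_fail_le (hact : ∀ k ∈ act, M.IsActive k (x k) (n k)) (hsel : M.IsRule K sel)
    {Q S ε t : ℝ} (hQ : ∀ k ∈ act, M.D k * x k = Q) (hS : ∑ k ∈ act, M.w k = S) (hS0 : 0 < S)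
    (hε0 : 0 < ε) (hε1 : ε ≤ 1) (ht : 0 < t) (hQ0 : 0 ≤ Q) (hK : 2 ≤ K)
    (hKε : 2 ≤ K * (ε / 52800) ^ 2) (hKQ : 12672000 * (t * Q) ≤ K * ε ^ 2 * S) :
    prob (M.laws K) {ω | ε * ∑ k ∈ act, M.est sel ω k ≤ |∑ k ∈ act, M.est sel ω k - S|} ≤
      2 * Real.exp (-(3 * t)) +
      25700 * Real.exp (-(K * (ε / 52800) ^ 2 / 4)) * (M.totalWeight act x n / S) +
      500000 * Real.exp (-(K / 2500)) * (M.totalWeight act x n / S) / ε := by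
  have hK0 : 0 < K := by omega
  have hK' : (0 : ℝ) < K := by exact_mod_cast hK0
  set θ := 60 * t / (ε * S) with hθ
  have hθ0 : 0 < θ := by positivity
  have hθK : 5280 * |θ| * Q ≤ K := by
    rw [abs_of_pos hθ0, hθ, ← mul_div_assoc, div_mul_eq_mul_div, div_le_iff₀ (by positivity)]
    have h1 : K * ε ^ 2 * S ≤ K * (ε * S) := by
      rw [sq, mul_assoc, mul_assoc]
      exact mul_le_mul_of_nonneg_left (mul_le_of_le_one_left (by positivity) hε1) hK'.le
    have h2 : 0 ≤ t * Q := by positivity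
    linarith
  have p1 := M.prob_centred_le hact hsel hQ θ (3 * t) hK0 hθK
  have p2 := M.prob_centred_le hact hsel hQ (-θ) (3 * t) hK0 (by rwa [abs_neg])
  have p3 := prob_le_expect_div (M.laws_nonneg (K := K))
    (E := {ω | ε * S / 20 ≤ M.biasExcess act n (ε / 52800) ω})
    (F := M.biasExcess act n (ε / 52800)) (by positivity : 0 < ε * S / 20)
    (fun ω => Finset.sum_nonneg fun k _ => Finset.sum_nonneg fun l _ =>
      mul_nonneg (M.w_nonneg k) (mul_nonneg (by positivity) (by positivity)))
    (fun ω hω => hω)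
  have p4 := prob_le_expect_div (M.laws_nonneg (K := K))
    (E := {ω | ε * S / 10 ≤ ∑ k ∈ act, M.damage (n k) sel ω k})
    (F := fun ω => ∑ k ∈ act, M.damage (n k) sel ω k) (by positivity : 0 < ε * S / 10)
    (fun ω => Finset.sum_nonneg fun k _ => M.damage_nonneg sel ω k)
    (fun ω hω => hω)
  have e3 := M.expect_biasExcess_le (K := K) hact (δ := ε / 52800) (by positivity) (by linarith)
    hKε
  have e4 : expect (M.laws K) (fun ω => ∑ k ∈ act, M.damage (n k) sel ω k) ≤
      50000 * Real.exp (-(K / 2500)) * M.totalWeight act x n := by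
    rw [expect_sum, totalWeight, Finset.mul_sum]
    exact Finset.sum_le_sum fun k hk => (hact k hk).expect_damage_le hsel hK
  have p3' := p3.trans (div_le_div_of_nonneg_right e3 (by positivity))
  have p4' := p4.trans (div_le_div_of_nonneg_right e4 (by positivity))
  have e5 : 67848000 * (ε / 52800) * Real.exp (-(K * (ε / 52800) ^ 2 / 4)) *
      M.totalWeight act x n / (ε * S / 20) =
      25700 * Real.exp (-(K * (ε / 52800) ^ 2 / 4)) * (M.totalWeight act x n / S) := by
    field_simp
    ring
  have e6 : 50000 * Real.exp (-((K : ℝ) / 2500)) * M.totalWeight act x n / (ε * S / 10) =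
      500000 * Real.exp (-(K / 2500)) * (M.totalWeight act x n / S) / ε := by
    field_simp
    ring
  rw [e5] at p3'
  rw [e6] at p4'
  refine (prob_mono M.laws_nonneg fun ω hω => ?_).trans
    ((prob_union_le M.laws_nonneg _ _).trans (add_le_add
      ((prob_union_le M.laws_nonneg _ _).trans (add_le_add
        ((prob_union_le M.laws_nonneg _ _).trans ((add_le_add p1 p2).trans_eq
          (two_mul _).symm)) p3')) p4'))
  by_contra hcon
  simp only [Set.mem_union, Set.mem_ofPred_eq, not_or, not_le] at hcon
  obtain ⟨⟨⟨h1, h2⟩, h3⟩, h4⟩ := hcon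
  exact absurd hω (not_le.2 (M.abs_sum_est_sub_lt_of_good hsel hS hS0 hε0 hε1 ht hQ0 hK0 hKQ
    h1 h2 h3 h4))

end CallModel

/-! ### Summing the weights: telescoping, entropy and numerical constants. -/

/-- The quotient of `(n+2y)/(4x+2y)` by `(n+y)/(4x+y)` is exactly `1 + z`, where `z ≤ 1` is the
weight at `q = 1/y`; then `log (1+z) ≥ z/2`. For dyadic `y` these differences telescope. -/
theorem rateWeight_le_log_sub_log {x n y : ℝ} (hn : 0 < n) (hxn : n ≤ 2 * x) (hy : 0 < y) :
    rateWeight x n y⁻¹ ≤ 2 * (Real.log ((n + 2 * y) / (4 * x + 2 * y)) -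
      Real.log ((n + y) / (4 * x + y))) := by
  have hx : 0 < x := by linarith
  set z := y * (4 * x - n) / ((4 * x + 2 * y) * (n + y)) with hz
  have hz0 : 0 ≤ z := div_nonneg (mul_nonneg hy.le (by linarith)) (by positivity)
  have hz1 : z ≤ 1 := by
    rw [hz, div_le_one (by positivity)]
    nlinarith [mul_pos hx hn, mul_pos hx hy, mul_pos hn hy]
  have h1 : rateWeight x n y⁻¹ = z := by
    rw [hz, rateWeight]
    field_simp
  have h2 : Real.log ((n + 2 * y) / (4 * x + 2 * y)) - Real.log ((n + y) / (4 * x + y)) =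
      Real.log (1 + z) := by
    rw [← Real.log_div (by positivity) (by positivity)]
    congr 1
    rw [hz]
    field_simp
    ring
  rw [h1, h2]
  have h3 := Real.one_sub_inv_le_log_of_pos (by linarith : 0 < 1 + z)
  have h4 : z / 2 ≤ 1 - (1 + z)⁻¹ := by
    have : 1 - (1 + z)⁻¹ = z / (1 + z) := by
      field_simp
      ring
    rw [this]
    exact div_le_div_of_nonneg_left hz0 (by linarith) (by linarith)
  linarith

theorem sum_rateWeight_le {m : ℕ} {x n : ℝ} (hn : 0 < n) (hxn : n ≤ 2 * x) :
    ∑ l : RateIdx m, rateWeight x n (rate l) ≤ 2 * Real.log (4 * x / n) := by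
  have hx : 0 < x := by linarith
  set φ : ℕ → ℝ := fun i => Real.log ((n + 2 ^ (i + 1)) / (4 * x + 2 ^ (i + 1))) with hφ
  have h1 : ∀ i : ℕ, rateWeight x n ((1 / 2) ^ (i + 1)) ≤ 2 * (φ (i + 1) - φ i) := by
    intro i
    have := rateWeight_le_log_sub_log hn hxn (y := 2 ^ (i + 1)) (by positivity)
    rw [one_div, inv_pow]
    simp only [hφ]
    rwa [pow_succ' 2 (i + 1)]
  have h0 : ∀ i : ℕ, 0 ≤ rateWeight x n ((1 / 2) ^ (i + 1)) := by
    intro i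
    unfold rateWeight
    exact div_nonneg (mul_nonneg (by linarith) (by positivity)) (by positivity)
  have h2 : ∑ l : RateIdx m, rateWeight x n (rate l) ≤
      ∑ i ∈ Finset.range m, rateWeight x n ((1 / 2) ^ (i + 1)) := by
    classical
    have hinj : Set.InjOn (fun l : RateIdx m => ((l : Fin m) : ℕ))
        (Finset.univ : Finset (RateIdx m)) :=
      fun l _ l' _ h => Subtype.ext (Fin.ext h)
    have h3 := Finset.sum_image (f := fun i : ℕ => rateWeight x n ((1 / 2) ^ (i + 1))) hinj
    refine h3.symm.le.trans (Finset.sum_le_sum_of_subset_of_nonneg ?_ fun i _ _ => h0 i)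
    intro i hi
    obtain ⟨l, -, rfl⟩ := Finset.mem_image.1 hi
    exact Finset.mem_range.2 (l : Fin m).is_lt
  refine h2.trans ((Finset.sum_le_sum fun i _ => h1 i).trans ?_)
  rw [← Finset.mul_sum, Finset.sum_range_sub]
  have h4 : φ m ≤ 0 := by
    refine Real.log_nonpos (by positivity) ?_
    rw [div_le_one (by positivity)]
    linarith
  have h5 : -Real.log (4 * x / n) ≤ φ 0 := by
    rw [← Real.log_inv, inv_div]
    refine Real.log_le_log (by positivity) ?_
    rw [div_le_div_iff₀ (by positivity) (by positivity), zero_add, pow_one]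
    linarith
  linarith

/-- A bound on the entropy of the distribution of `S` over finitely many parts. -/
theorem sum_mul_log_div_le {κ : Type*} {act : Finset κ} {w : κ → ℝ} {S : ℝ}
    (hw : ∀ k ∈ act, 0 < w k) (hS : ∑ k ∈ act, w k = S) (hS0 : 0 < S) :
    ∑ k ∈ act, w k * Real.log (S / w k) ≤ S * Real.log act.card := by
  have hne : act.Nonempty := by
    by_contra h
    rw [Finset.not_nonempty_iff_eq_empty] at h
    rw [h, Finset.sum_empty] at hS
    linarith
  have hN : (0 : ℝ) < act.card := by exact_mod_cast hne.card_pos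
  have h1 : ∀ k ∈ act, w k * Real.log (S / w k) ≤
      w k * Real.log act.card + (S / act.card - w k) := by
    intro k hk
    have hk0 := hw k hk
    -- The inequality `log u ≤ u - 1`, with equality when all parts are equal.
    have h2 := Real.log_le_sub_one_of_pos (by positivity : 0 < S / w k / act.card)
    rw [Real.log_div (by positivity) hN.ne'] at h2
    have h3 := mul_le_mul_of_nonneg_left h2 hk0.le
    have h4 : w k * (S / w k / act.card - 1) = S / act.card - w k := by
      field_simp
    linarith
  refine (Finset.sum_le_sum h1).trans ?_
  rw [Finset.sum_add_distrib, Finset.sum_sub_distrib, ← Finset.sum_mul, hS, Finset.sum_const,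
    nsmul_eq_mul, mul_div_cancel₀ _ hN.ne']
  linarith

/-- The numerical bound on the failure probability. -/
theorem fail_bound_le {C t ε K G : ℝ} (hC : 1 / 2 ≤ C) (ht : 1 ≤ t) (hε0 : 0 < ε) (hε1 : ε ≤ 1)
    (hK : 10 ^ 12 * (C * t / ε ^ 2) ≤ K) (hG : G ≤ 21 * Real.exp (C * t)) :
    2 * Real.exp (-(3 * t)) + 25700 * Real.exp (-(K * (ε / 52800) ^ 2 / 4)) * G +
      500000 * Real.exp (-(K / 2500)) * G / ε ≤ Real.exp (-t) := by
  set y := C * t with hy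
  have hy1 : t ≤ 2 * y := by nlinarith
  have hy2 : 1 / 2 ≤ y := by linarith
  have hKε : 10 ^ 12 * y ≤ K * ε ^ 2 := by
    rwa [← mul_div_assoc, div_le_iff₀ (by positivity)] at hK
  have hinv : 1 ≤ 1 / ε ^ 2 := by
    rw [le_div_iff₀ (by positivity)]
    nlinarith
  have e1 : 2 * Real.exp (-(3 * t)) ≤ 1 / 2 * Real.exp (-t) := by
    have h1 : Real.exp (-(3 * t)) = Real.exp (-t) * Real.exp (-(2 * t)) := by
      rw [← Real.exp_add]
      ring_nf
    have h2 : Real.exp (-(2 * t)) ≤ 1 / 4 := by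
      calc Real.exp (-(2 * t)) ≤ Real.exp (-2) := Real.exp_le_exp.2 (by linarith)
        _ = (Real.exp 1)⁻¹ ^ 2 := by
          rw [← Real.exp_neg, ← Real.exp_nat_mul]
          norm_num
        _ ≤ (1 / 2) ^ 2 := by
          refine pow_le_pow_left₀ (by positivity) ?_ 2
          rw [← one_div]
          exact one_div_le_one_div_of_le (by norm_num) (by linarith [Real.add_one_le_exp (1 : ℝ)])
        _ = 1 / 4 := by norm_num
    nlinarith [Real.exp_pos (-t)]
  have hsmall : Real.exp (-(38 : ℝ)) ≤ 1 / 2 ^ 38 := by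
    calc Real.exp (-38) = (Real.exp 1)⁻¹ ^ 38 := by
          rw [← Real.exp_neg, ← Real.exp_nat_mul]
          norm_num
      _ ≤ (1 / 2) ^ 38 := by
          refine pow_le_pow_left₀ (by positivity) ?_ _
          rw [← one_div]
          exact one_div_le_one_div_of_le (by norm_num) (by linarith [Real.add_one_le_exp (1 : ℝ)])
      _ = _ := by norm_num
  -- An exponent `t + y + 38` pays for the target `e^(-t)`, for the weight `e^y`, and for the
  -- numerical constants through `2^(-38)`.
  have hprod : ∀ s : ℝ, t + y + 38 ≤ s → Real.exp (-s) * (21 * Real.exp y) ≤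
      Real.exp (-t) * (21 / 2 ^ 38) := by
    intro s hs
    calc _ = 21 * Real.exp (-s + y) := by
          rw [Real.exp_add]
          ring
      _ ≤ 21 * Real.exp (-t + -38) :=
          mul_le_mul_of_nonneg_left (Real.exp_le_exp.2 (by linarith)) (by norm_num)
      _ = Real.exp (-t) * (21 * Real.exp (-38)) := by
          rw [Real.exp_add]
          ring
      _ ≤ Real.exp (-t) * (21 * (1 / 2 ^ 38)) := by gcongr
      _ = _ := by ring
  have e2 : 25700 * Real.exp (-(K * (ε / 52800) ^ 2 / 4)) * G ≤ 1 / 4 * Real.exp (-t) := by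
    have h1 := hprod (K * (ε / 52800) ^ 2 / 4) (by
      have : K * (ε / 52800) ^ 2 / 4 = K * ε ^ 2 / (4 * 52800 ^ 2) := by ring
      rw [this, le_div_iff₀ (by norm_num)]
      linarith)
    have h2 := mul_le_mul_of_nonneg_left hG
      (Real.exp_pos (-(K * (ε / 52800) ^ 2 / 4))).le
    have h3 := Real.exp_pos (-t)
    linarith
  have e3 : 500000 * Real.exp (-(K / 2500)) * G / ε ≤ 1 / 4 * Real.exp (-t) := by
    -- The factor `1/ε` from Markov's inequality is absorbed in the exponent, as `K / 2500` is a
    -- large multiple of `1/ε²`.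
    have h0 : 1 / ε ≤ Real.exp (1 / ε ^ 2) := by
      have h1 := Real.add_one_le_exp (1 / ε ^ 2)
      have h2 : 1 / ε ≤ 1 / ε ^ 2 := one_div_le_one_div_of_le (by positivity) (by nlinarith)
      linarith
    have h1 := hprod (K / 2500 - 1 / ε ^ 2) (by
      have h5 : y * (1 / ε ^ 2) = y / ε ^ 2 := mul_one_div _ _
      have h6 : y ≤ y * (1 / ε ^ 2) := le_mul_of_one_le_right (by linarith) hinv
      have h7 : 1 / 2 * (1 / ε ^ 2) ≤ y * (1 / ε ^ 2) :=
        mul_le_mul_of_nonneg_right hy2 (by linarith)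
      linarith)
    have h2 := mul_le_mul_of_nonneg_left hG (Real.exp_pos (-(K / 2500))).le
    have h3 := Real.exp_pos (-t)
    have h4 : 0 ≤ Real.exp (-(K / 2500)) * (21 * Real.exp y) := by positivity
    rw [show -(K / 2500 - 1 / ε ^ 2) = -(K / 2500) + 1 / ε ^ 2 by ring, Real.exp_add] at h1
    calc 500000 * Real.exp (-(K / 2500)) * G / ε =
          500000 * ((Real.exp (-(K / 2500)) * G) * (1 / ε)) := by ring
      _ ≤ 500000 * ((Real.exp (-(K / 2500)) * (21 * Real.exp y)) * Real.exp (1 / ε ^ 2)) := by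
          refine mul_le_mul_of_nonneg_left ?_ (by norm_num)
          exact mul_le_mul h2 h0 (by positivity) h4
      _ ≤ _ := by linarith
  linarith

/-! ### The sampling procedure as a call model. -/

/-- Labels as positions with two additional points. -/
def labelEquiv (m : ℕ) : Label m ≃ Option (Option (Fin m)) where
  toFun
    | .isMatch => none
    | .bot => some none
    | .mismatchAt j => some (some j)
  invFun
    | none => .isMatch
    | some none => .bot
    | some (some j) => .mismatchAt j
  left_inv L := by cases L <;> rfl
  right_inv o := by rcases o with _ | _ | j <;> rfl

instance (m : ℕ) : Fintype (Label m) := Fintype.ofEquiv _ (labelEquiv m).symm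

instance (m : ℕ) : MeasurableSpace (Label m) := ⊤

instance (m : ℕ) : DiscreteMeasurableSpace (Label m) := ⟨fun _ => trivial⟩

theorem sum_label {m : ℕ} (f : Label m → ℝ) :
    ∑ L, f L = f .isMatch + (f .bot + ∑ j, f (.mismatchAt j)) := by
  rw [← (labelEquiv m).symm.sum_comp, Fintype.sum_option, Fintype.sum_option]
  rfl

/-- Whether a label is "match". -/
def Label.isHit {m : ℕ} : Label m → Bool
  | .isMatch => true
  | .mismatchAt _ => false
  | .bot => false

theorem Label.matchCount_eq {m : ℕ} (L : Label m) :
    L.matchCount = if L.isHit then 1 else 0 := by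
  cases L <;> simp [matchCount, isHit]

theorem Label.distAt_nonneg {A : Type*} [MetricSpace A] {m : ℕ} (D : ℝ) (p t : Fin m → A)
    (L : Label m) : 0 ≤ L.distAt D p t := by
  cases L <;> simp only [distAt, le_refl]
  split_ifs
  exacts [dist_nonneg, le_rfl]

theorem Label.distAt_le {A : Type*} [MetricSpace A] {m : ℕ} {D : ℝ} (hD : 0 < D)
    (p t : Fin m → A) (L : Label m) : L.distAt D p t ≤ 2 * D := by
  cases L <;> simp only [distAt]
  · positivity
  · split_ifs with h
    exacts [h.2.le, by positivity]
  · positivity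

theorem labelProb_eq_map_real {A : Type*} [Fintype A] {m : ℕ} (H : PMF (A → ℕ)) (l : RateIdx m)
    (p t : Fin m → A) (L : Label m) :
    labelProb H l p t L = ((seedLaw H l).map fun s => sampleLabel s p t).real {L} := by
  rw [map_measureReal_apply Measurable.of_discrete MeasurableSet.of_discrete]
  rfl

instance {A : Type*} [Fintype A] {m : ℕ} (H : PMF (A → ℕ)) (l : RateIdx m) (p t : Fin m → A) :
    IsProbabilityMeasure ((seedLaw H l).map fun s => sampleLabel s p t) :=
  Measure.isProbabilityMeasure_map Measurable.of_discrete.aemeasurable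

theorem sum_labelProb {A : Type*} [Fintype A] {m : ℕ} (H : PMF (A → ℕ)) (l : RateIdx m)
    (p t : Fin m → A) : ∑ L, labelProb H l p t L = 1 := by
  simp only [labelProb_eq_map_real]
  rw [sum_measureReal_singleton]
  simp

theorem scale_pos {B : ℝ} (k : ScaleIdx B) : 0 < scale k := by
  unfold scale
  positivity

/-- The part of the distance that comes from positions with distance in `[D, 2 D)`. -/
def distPart {A : Type*} [MetricSpace A] {m : ℕ} (D : ℝ) (p t : Fin m → A) : ℝ :=
  ∑ j, Label.distAt D p t (.mismatchAt j)

/-- Only positions at distance at least `D` contribute, and those are separated by every hash, so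
`labelProb_mismatchAt` applies term by term. -/
theorem mean_distAt {A : Type*} [Fintype A] [MetricSpace A] {m : ℕ} {C D : ℝ}
    {H : PMF (A → ℕ)} (hH : IsProbSeparating C D H) (l : RateIdx m) (p t : Fin m → A) :
    (1 - rate l) * ∑ L, labelProb H l p t L * L.distAt D p t =
      rate l * (∑ L : Label m, labelProb H l p t L * if L.isHit then 1 else 0) *
        distPart D p t := by
  rw [sum_label, sum_label]
  simp only [Label.isHit, if_true, Label.distAt, distPart, mul_zero, zero_add, mul_one,
    Bool.false_eq_true, if_false, Finset.sum_const_zero, add_zero]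
  rw [Finset.mul_sum, Finset.mul_sum]
  refine Finset.sum_congr rfl fun j _ => ?_
  split_ifs with h
  · rw [← mul_assoc, labelProb_mismatchAt H l p t j]
    intro π hπ
    exact hH.1 _ _ (by rw [dist_comm]; exact h.1) π hπ
  · simp

/-- The sampling procedure on a pattern and a text window as a model of calls. -/
def callModel {A : Type*} [Fintype A] [MetricSpace A] {m : ℕ} {B C : ℝ}
    (H : ScaleIdx B → PMF (A → ℕ)) (hH : ∀ k, IsProbSeparating C (scale k) (H k))
    (p t : Fin m → A) : CallModel (ScaleIdx B) (RateIdx m) (Label m) where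
  law k l L := labelProb (H k) l p t L
  law_nonneg k l L := labelProb_nonneg _ _ _ _ _
  law_sum k l := sum_labelProb _ _ _ _
  hit := Label.isHit
  val k L := L.distAt (scale k) p t
  val_nonneg k L := L.distAt_nonneg _ _ _
  val_hit k L hL := by cases L <;> simp_all [Label.isHit, Label.distAt]
  D := scale
  D_pos := scale_pos
  val_le k L := L.distAt_le (scale_pos k) _ _
  q := rate
  q_pos := rate_pos
  q_le := rate_le_half
  w k := distPart (scale k) p t
  w_nonneg k := Finset.sum_nonneg fun j _ => Label.distAt_nonneg _ _ _ _
  mean_val k l := mean_distAt (hH k) l p t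

section CallModel

variable {A : Type*} [Fintype A] [MetricSpace A] {m : ℕ} {B C : ℝ}
  {H : ScaleIdx B → PMF (A → ℕ)} (hH : ∀ k, IsProbSeparating C (scale k) (H k))
  (p t : Fin m → A)

theorem callModel_p (k : ScaleIdx B) (l : RateIdx m) :
    (callModel H hH p t).p k l = labelProb (H k) l p t .isMatch := by
  unfold CallModel.p CallModel.ind
  rw [sum_label]
  simp [callModel, Label.isHit]

/-- The labels of all calls. -/
def runLabels {K : ℕ} (ω : Run A m B K) (c : ScaleIdx B × RateIdx m × Fin K) : Label m :=
  sampleLabel (ω c) p t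

theorem numMatches_eq_cnt {K : ℕ} (ω : Run A m B K) (k : ScaleIdx B) :
    numMatches ω p t k = (callModel H hH p t).cnt (runLabels p t ω) k := by
  ext l
  simp only [numMatches, CallModel.cnt, Label.matchCount_eq]
  rfl

theorem scaleEstimate_eq_est {K : ℕ} (sel : (RateIdx m → ℕ) → Option (RateIdx m))
    (ω : Run A m B K) (k : ScaleIdx B) :
    scaleEstimate sel ω p t k = (callModel H hH p t).est sel (runLabels p t ω) k := by
  unfold scaleEstimate CallModel.est
  rw [numMatches_eq_cnt hH]
  cases sel ((callModel H hH p t).cnt (runLabels p t ω) k) <;> rfl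

/-- Events of a run that depend only on the labels. -/
theorem runLaw_real_eq_prob (K : ℕ) (E : Set (ScaleIdx B × RateIdx m × Fin K → Label m)) :
    (runLaw m B K H).real {ω | runLabels p t ω ∈ E} =
      prob ((callModel H hH p t).laws K) E := by
  have h1 : (runLaw m B K H).map (runLabels p t) =
      Measure.pi fun c : ScaleIdx B × RateIdx m × Fin K =>
        (seedLaw (H c.1) c.2.1).map fun s => sampleLabel s p t := by
    unfold runLaw
    exact Measure.pi_map_pi (f := fun _ s => sampleLabel s p t)
      fun c => Measurable.of_discrete.aemeasurable
  have h2 : Measurable (runLabels p t : Run A m B K → _) :=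
    measurable_pi_lambda _ fun c =>
      (Measurable.of_discrete (f := fun s => sampleLabel s p t)).comp (measurable_pi_apply c)
  have h3 : (runLaw m B K H).real {ω | runLabels p t ω ∈ E} =
      ((runLaw m B K H).map (runLabels p t)).real E := by
    rw [map_measureReal_apply h2 MeasurableSet.of_discrete]
    rfl
  rw [h3, h1, pi_real_eq_prob]
  congr 1
  ext c L
  exact (labelProb_eq_map_real _ _ _ _ _).symm

end CallModel

/-! ### Decomposition of the distance into dyadic scales. -/

section Scales

variable {A : Type*} [MetricSpace A] {m : ℕ} {B : ℝ} (p t : Fin m → A)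

/-- The positions with distance in `[D, 2 D)`. -/
def positions (D : ℝ) : Finset (Fin m) :=
  {j | D ≤ dist (t j) (p j) ∧ dist (t j) (p j) < 2 * D}

theorem mem_positions {D : ℝ} {j : Fin m} :
    j ∈ positions p t D ↔ D ≤ dist (t j) (p j) ∧ dist (t j) (p j) < 2 * D := by
  simp [positions]

theorem distPart_eq (D : ℝ) : distPart D p t = ∑ j ∈ positions p t D, dist (t j) (p j) := by
  simp [distPart, Label.distAt, positions, Finset.sum_filter]

theorem mul_card_positions_le (D : ℝ) : D * (positions p t D).card ≤ distPart D p t := by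
  rw [distPart_eq, mul_comm, ← nsmul_eq_mul]
  exact Finset.card_nsmul_le_sum _ _ _ fun j hj => ((mem_positions p t).1 hj).1

theorem distPart_le (D : ℝ) : distPart D p t ≤ 2 * D * (positions p t D).card := by
  rw [distPart_eq, mul_comm, ← nsmul_eq_mul]
  exact Finset.sum_le_card_nsmul _ _ _ fun j hj => ((mem_positions p t).1 hj).2.le

theorem scale_unique {k k' : ScaleIdx B} {d : ℝ} (h1 : scale k ≤ d) (h2 : d < 2 * scale k)
    (h1' : scale k' ≤ d) (h2' : d < 2 * scale k') : k = k' := by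
  unfold scale at *
  rw [← pow_succ'] at h2 h2'
  have a := (pow_lt_pow_iff_right₀ (by norm_num : (1 : ℝ) < 2)).1 (h1.trans_lt h2')
  have b := (pow_lt_pow_iff_right₀ (by norm_num : (1 : ℝ) < 2)).1 (h1'.trans_lt h2)
  exact Fin.ext (by omega)

theorem exists_scale {d : ℝ} (h1 : 1 ≤ d) (hB : d ≤ B) :
    ∃ k : ScaleIdx B, scale k ≤ d ∧ d < 2 * scale k := by
  have hfl : ⌊d⌋₊ ≠ 0 := (Nat.floor_pos.2 h1).ne'
  refine ⟨⟨Nat.log 2 ⌊d⌋₊, Nat.lt_succ_of_le (Nat.log_mono_right (Nat.floor_mono hB))⟩, ?_, ?_⟩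
  · unfold scale
    calc (2 : ℝ) ^ Nat.log 2 ⌊d⌋₊ ≤ (⌊d⌋₊ : ℝ) := by
          exact_mod_cast Nat.pow_log_le_self 2 hfl
      _ ≤ d := Nat.floor_le (by linarith)
  · unfold scale
    rw [← pow_succ']
    have h2 : ⌊d⌋₊ + 1 ≤ 2 ^ (Nat.log 2 ⌊d⌋₊ + 1) :=
      Nat.lt_pow_succ_log_self (by norm_num) _
    calc d < ⌊d⌋₊ + 1 := Nat.lt_floor_add_one d
      _ ≤ 2 ^ (Nat.log 2 ⌊d⌋₊ + 1) := by exact_mod_cast h2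

theorem sum_distPart (h1 : ∀ x y : A, x ≠ y → 1 ≤ dist x y) (hB : ∀ x y : A, dist x y ≤ B) :
    ∑ k : ScaleIdx B, distPart (scale k) p t = ∑ j, dist (p j) (t j) := by
  unfold distPart
  rw [Finset.sum_comm]
  refine Finset.sum_congr rfl fun j _ => ?_
  by_cases hj : t j = p j
  · refine (Finset.sum_eq_zero fun k _ => ?_).trans (by simp [hj])
    simp [Label.distAt, hj]
  · obtain ⟨k, hk1, hk2⟩ := exists_scale (h1 _ _ hj) (hB (t j) (p j))
    rw [Finset.sum_eq_single k, dist_comm (p j)]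
    · simp [Label.distAt, hk1, hk2]
    · intro k' _ hk'
      simp only [Label.distAt]
      exact if_neg fun h => hk' (scale_unique h.1 h.2 hk1 hk2)
    · simp

/-- The scales that contribute to the distance. -/
def activeScales (B : ℝ) : Finset (ScaleIdx B) := {k | (positions p t (scale k)).Nonempty}

theorem mem_activeScales {k : ScaleIdx B} :
    k ∈ activeScales p t B ↔ (positions p t (scale k)).Nonempty := by
  simp [activeScales]

theorem positions_eq_empty {k : ScaleIdx B} (hk : k ∉ activeScales p t B) :
    positions p t (scale k) = ∅ := by
  rwa [mem_activeScales, Finset.not_nonempty_iff_eq_empty] at hk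

/-- A contributing scale is witnessed by a pair of letters, and the distance of a pair determines
its scale. This replaces a bound in terms of `log B`. -/
theorem card_activeScales_le [Fintype A] :
    (activeScales p t B).card ≤ Fintype.card A ^ 2 := by
  have hch : ∀ k : activeScales p t B, ∃ a : A × A,
      scale (k : ScaleIdx B) ≤ dist a.1 a.2 ∧ dist a.1 a.2 < 2 * scale (k : ScaleIdx B) := by
    intro k
    obtain ⟨j, hj⟩ := (mem_activeScales p t).1 k.2
    exact ⟨(t j, p j), (mem_positions p t).1 hj⟩
  choose f hf using hch
  have hinj : Function.Injective f := by
    intro k k' h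
    have h1 := hf k
    rw [h] at h1
    exact Subtype.ext (scale_unique h1.1 h1.2 (hf k').1 (hf k').2)
  simpa [sq] using Fintype.card_le_of_injective f hinj

theorem scaleEstimate_eq_zero {K : ℕ} (sel : (RateIdx m → ℕ) → Option (RateIdx m))
    (ω : Run A m B K) {k : ScaleIdx B} (hk : k ∉ activeScales p t B) :
    scaleEstimate sel ω p t k = 0 := by
  have h1 : ∀ L : Label m, L.distAt (scale k) p t = 0 := by
    intro L
    cases L with
    | mismatchAt j =>
      refine if_neg fun h => ?_
      have := (mem_positions p t).2 h
      rw [positions_eq_empty p t hk] at this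
      simp at this
    | _ => rfl
  have h2 : ∀ l, distSum ω p t k l = 0 := fun l => Finset.sum_eq_zero fun r _ => h1 _
  unfold scaleEstimate
  cases sel (numMatches ω p t k) <;> simp [h2]

theorem sum_scaleEstimate_eq_zero {K : ℕ} (sel : (RateIdx m → ℕ) → Option (RateIdx m))
    (h0 : ∑ j, dist (p j) (t j) = 0) (ω : Run A m B K) :
    ∑ k, scaleEstimate sel ω p t k = 0 := by
  refine Finset.sum_eq_zero fun k _ => scaleEstimate_eq_zero p t sel ω fun hk => ?_
  obtain ⟨j, hj⟩ := (mem_activeScales p t).1 hk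
  have h2 := (Finset.sum_eq_zero_iff_of_nonneg fun j _ => dist_nonneg).1 h0 j (Finset.mem_univ j)
  have h3 := ((mem_positions p t).1 hj).1
  rw [dist_comm, h2] at h3
  exact absurd (scale_pos k) (not_lt.2 h3)

end Scales

/-! ### Verification of the hypotheses and conclusion. -/

section Main

variable {A : Type*} [Fintype A] [MetricSpace A] {m : ℕ} {B C : ℝ}
  {H : ScaleIdx B → PMF (A → ℕ)} (p t : Fin m → A)

/-- A pair with `D ≤ d < 2D` is separated with probability one, so the two separation properties
give `1 ≤ C d/D` with `d/D < 2`. -/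
theorem half_le_of_mem_activeScales (hH : ∀ k, IsProbSeparating C (scale k) (H k))
    {k : ScaleIdx B} (hk : k ∈ activeScales p t B) : 1 / 2 ≤ C := by
  obtain ⟨j, hj⟩ := (mem_activeScales p t).1 hk
  obtain ⟨h1, h2⟩ := (mem_positions p t).1 hj
  have hD := scale_pos k
  have h3 := (hH k).2 (t j) (p j)
  have h4 : (H k).toMeasure {π | π (t j) ≠ π (p j)} = 1 :=
    (PMF.toMeasure_apply_eq_one_iff _ MeasurableSet.of_discrete).2 ((hH k).1 _ _ h1)
  rw [measureReal_def, h4, ENNReal.toReal_one] at h3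
  have h5 : dist (t j) (p j) / scale k < 2 := by
    rwa [div_lt_iff₀ hD]
  have h6 : 1 ≤ dist (t j) (p j) / scale k := by
    rwa [one_le_div hD]
  nlinarith

theorem isActive_of_mem_activeScales (hm : 3 ≤ m)
    (hH : ∀ k, IsProbSeparating C (scale k) (H k))
    (hS : ∀ k : ScaleIdx B, distPart (scale k) p t ≤ ∑ j, dist (p j) (t j))
    {k : ScaleIdx B} (hk : k ∈ activeScales p t B) :
    (callModel H hH p t).IsActive k (C * (∑ j, dist (p j) (t j)) / scale k)
      (positions p t (scale k)).card := by
  have hC := half_le_of_mem_activeScales p t hH hk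
  have hD := scale_pos k
  have hn : 1 ≤ (positions p t (scale k)).card :=
    Finset.card_pos.2 ((mem_activeScales p t).1 hk)
  have hX : ∀ π ∈ (H k).support,
      (positions p t (scale k)).card ≤ (hashMismatches p t π).card := by
    intro π hπ
    refine Finset.card_le_card fun j hj => mem_hashMismatches.2 ?_
    have := ((mem_positions p t).1 hj).1
    rw [dist_comm] at this
    exact (hH k).1 _ _ this π hπ
  have hp := fun l => labelProb_isMatch_le_pow (H k) l p t hX
  refine ⟨by exact_mod_cast hn, ?_, fun l => ?_, fun l => ?_, fun l hl => ?_, fun l hl => ?_, ?_⟩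
  · have h1 := (mul_card_positions_le p t (scale k)).trans (hS k)
    rw [← mul_div_assoc, le_div_iff₀ hD]
    have h2 : 0 ≤ ∑ j, dist (p j) (t j) := Finset.sum_nonneg fun j _ => dist_nonneg
    nlinarith
  · rw [callModel_p]
    refine (hp l).trans ?_
    have h1 := rate_le_half l
    calc (1 - rate l) ^ (positions p t (scale k)).card
        ≤ Real.exp (-rate l) ^ (positions p t (scale k)).card :=
          pow_le_pow_left₀ (by linarith) (Real.one_sub_le_exp_neg _) _
      _ = Real.exp (-((positions p t (scale k)).card * rate l)) := by
          rw [← Real.exp_nat_mul, mul_neg]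
  · rw [callModel_p, mul_comm]
    exact one_sub_labelProb_isMatch_le (H k) l p t (hH k)
  · rw [callModel_p]
    refine (hp l).trans ?_
    have h1 : rate l = 1 / 2 := hl
    rw [h1]
    calc ((1 : ℝ) - 1 / 2) ^ (positions p t (scale k)).card ≤ (1 - 1 / 2) ^ 1 :=
          pow_le_pow_of_le_one (by norm_num) (by norm_num) hn
      _ = 1 / 2 := by norm_num
  · obtain ⟨l', hl'⟩ := exists_rate_eq_two_mul l hl
    refine ⟨l', hl', ?_⟩
    rw [callModel_p, callModel_p]
    exact one_sub_labelProb_isMatch_le_of_rate_double (H k) p t hl'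
  · obtain ⟨l, hl⟩ := exists_rate_with_large_matchProb hm
    refine ⟨l, ?_⟩
    rw [callModel_p]
    exact hl.trans (pow_le_labelProb_isMatch (H k) l p t)

/-- With `w ≤ 2Dn` the telescoped sum at a scale is at most `2 log (8 C S / w)`. The average of `log
(S/w)` is an entropy over the active scales, at most `2 log |A|`; `log (8C)` is negligible against
`exp (C s)`. -/
theorem totalWeight_le (hH : ∀ k, IsProbSeparating C (scale k) (H k)) {S s : ℝ}
    (hC : 1 / 2 ≤ C) (hs : 1 ≤ s) (hcard : Real.log (Fintype.card A) ≤ Real.exp (C * s))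
    (hS0 : 0 < S) (hS : ∑ k ∈ activeScales p t B, distPart (scale k) p t = S)
    (hSle : ∀ k : ScaleIdx B, distPart (scale k) p t ≤ S) :
    (callModel H hH p t).totalWeight (activeScales p t B) (fun k => C * S / scale k)
      (fun k => (positions p t (scale k)).card) / S ≤ 21 * Real.exp (C * s) := by
  set act := activeScales p t B with hact
  have hpos : ∀ k ∈ act, 0 < distPart (scale k) p t := by
    intro k hk
    have h1 := mul_card_positions_le p t (scale k)
    have h2 : 0 < (positions p t (scale k)).card :=
      Finset.card_pos.2 ((mem_activeScales p t).1 hk)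
    have h3 := scale_pos k
    exact lt_of_lt_of_le (by positivity) h1
  have hne : act.Nonempty := by
    by_contra h
    rw [Finset.not_nonempty_iff_eq_empty] at h
    rw [h, Finset.sum_empty] at hS
    linarith
  have hterm : ∀ k ∈ act, distPart (scale k) p t * (1 + ∑ l : RateIdx m,
      rateWeight (C * S / scale k) (positions p t (scale k)).card (rate l)) ≤
      distPart (scale k) p t * (1 + 2 * Real.log (8 * C)) +
        2 * (distPart (scale k) p t * Real.log (S / distPart (scale k) p t)) := by
    intro k hk
    have hw := hpos k hk
    have hD := scale_pos k
    have hn : (0 : ℝ) < (positions p t (scale k)).card := by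
      exact_mod_cast Finset.card_pos.2 ((mem_activeScales p t).1 hk)
    have h1 := (mul_card_positions_le p t (scale k)).trans (hSle k)
    have h2 := sum_rateWeight_le (m := m) (x := C * S / scale k) hn (by
      rw [← mul_div_assoc, le_div_iff₀ hD]
      nlinarith)
    have h3 : Real.log (4 * (C * S / scale k) / (positions p t (scale k)).card) ≤
        Real.log (8 * C) + Real.log (S / distPart (scale k) p t) := by
      rw [← Real.log_mul (by positivity) (by positivity)]
      refine Real.log_le_log (by positivity) ?_
      have h4 := distPart_le p t (scale k)
      rw [← mul_div_assoc, ← mul_div_assoc, div_div, div_le_div_iff₀ (by positivity) hw]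
      have := mul_le_mul_of_nonneg_left h4 (by positivity : 0 ≤ 4 * (C * S))
      linarith
    have h5 : 1 + ∑ l : RateIdx m,
        rateWeight (C * S / scale k) (positions p t (scale k)).card (rate l) ≤
        1 + 2 * (Real.log (8 * C) + Real.log (S / distPart (scale k) p t)) := by
      linarith
    have := mul_le_mul_of_nonneg_left h5 hw.le
    linarith
  have hent := sum_mul_log_div_le hpos hS hS0
  have hN : Real.log act.card ≤ 2 * Real.exp (C * s) := by
    have h1 : (act.card : ℝ) ≤ (Fintype.card A : ℝ) ^ 2 := by
      exact_mod_cast card_activeScales_le p t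
    have h2 := Real.log_le_log (by exact_mod_cast hne.card_pos) h1
    rw [Real.log_pow] at h2
    push_cast at h2
    linarith
  have hCs : C ≤ C * s := le_mul_of_one_le_right (by linarith) hs
  have hexp := Real.add_one_le_exp (C * s)
  have hlogC : Real.log (8 * C) ≤ 8 * C := by
    have := Real.log_le_sub_one_of_pos (by positivity : 0 < 8 * C)
    linarith
  rw [div_le_iff₀ hS0]
  calc _ ≤ ∑ k ∈ act, (distPart (scale k) p t * (1 + 2 * Real.log (8 * C)) +
        2 * (distPart (scale k) p t * Real.log (S / distPart (scale k) p t))) :=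
        Finset.sum_le_sum hterm
    _ ≤ S * (1 + 2 * Real.log (8 * C)) + 2 * (S * Real.log act.card) := by
        rw [Finset.sum_add_distrib, ← Finset.sum_mul, hS, ← Finset.mul_sum]
        linarith
    _ = S * (1 + 2 * Real.log (8 * C) + 2 * Real.log act.card) := by ring
    _ ≤ S * (21 * Real.exp (C * s)) := mul_le_mul_of_nonneg_left (by linarith) hS0.le
    _ = _ := mul_comm _ _

theorem runLaw_fail_le (hm : 3 ≤ m) {K : ℕ} {ε s : ℝ}
    (h1 : ∀ x y : A, x ≠ y → 1 ≤ dist x y) (hB : ∀ x y : A, dist x y ≤ B)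
    (hH : ∀ k, IsProbSeparating C (scale k) (H k))
    (hcard : Real.log (Fintype.card A) ≤ Real.exp (C * s)) (hε0 : 0 < ε) (hε1 : ε ≤ 1)
    (hs : 1 ≤ s) (hK : 10 ^ 12 * (C * s / ε ^ 2) ≤ K)
    {sel : (RateIdx m → ℕ) → Option (RateIdx m)} (hsel : IsRateRule K sel)
    (hne : ∑ j, dist (p j) (t j) ≠ 0) :
    (runLaw m B K H).real {ω | ε * ∑ k, scaleEstimate sel ω p t k ≤
      |∑ k, scaleEstimate sel ω p t k - ∑ j, dist (p j) (t j)|} ≤ Real.exp (-s) := by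
  have hsum := sum_distPart (B := B) p t h1 hB
  set S := ∑ j, dist (p j) (t j) with hS
  have hS0 : 0 < S := lt_of_le_of_ne (Finset.sum_nonneg fun j _ => dist_nonneg) hne.symm
  have hSle : ∀ k : ScaleIdx B, distPart (scale k) p t ≤ S := fun k => by
    rw [← hsum]
    exact Finset.single_le_sum (f := fun k : ScaleIdx B => distPart (scale k) p t)
      (fun k _ => Finset.sum_nonneg fun j _ => Label.distAt_nonneg _ _ _ _) (Finset.mem_univ k)
  have hact : ∑ k ∈ activeScales p t B, distPart (scale k) p t = S := by
    rw [← hsum]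
    refine Finset.sum_subset (Finset.subset_univ _) fun k _ hk => ?_
    rw [distPart_eq, positions_eq_empty p t hk, Finset.sum_empty]
  obtain ⟨k₀, hk₀⟩ : (activeScales p t B).Nonempty := by
    by_contra h
    rw [Finset.not_nonempty_iff_eq_empty] at h
    rw [h, Finset.sum_empty] at hact
    linarith
  have hC := half_le_of_mem_activeScales p t hH hk₀
  have hKε : 10 ^ 12 * (C * s) ≤ K * ε ^ 2 := by
    rwa [← mul_div_assoc, div_le_iff₀ (by positivity)] at hK
  have hCs : 1 / 2 ≤ C * s := by nlinarith
  have hε2 : ε ^ 2 ≤ 1 := pow_le_one₀ hε0.le hε1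
  have hK2 : 2 ≤ K := by
    have h2 : K * ε ^ 2 ≤ K := mul_le_of_le_one_right (Nat.cast_nonneg K) hε2
    have h3 : (2 : ℝ) ≤ K := by linarith
    exact_mod_cast h3
  -- `Q = C S` is the scale-free value of `D x` for `x = C S / D`.
  have key := (callModel H hH p t).prob_fail_le (K := K) (sel := sel) (Q := C * S) (t := s)
    (fun k hk => isActive_of_mem_activeScales p t hm hH hSle hk) hsel
    (fun k _ => mul_div_cancel₀ _ (scale_pos k).ne') hact hS0 hε0 hε1 (by linarith)
    (by positivity) hK2 (by linarith) (by nlinarith)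
  have hest : ∀ ω : Run A m B K, ∑ k, scaleEstimate sel ω p t k =
      ∑ k ∈ activeScales p t B, (callModel H hH p t).est sel (runLabels p t ω) k := by
    intro ω
    rw [← Finset.sum_subset (Finset.subset_univ (activeScales p t B))
      fun k _ hk => scaleEstimate_eq_zero p t sel ω hk]
    exact Finset.sum_congr rfl fun k _ => scaleEstimate_eq_est hH p t sel ω k
  simp only [hest]
  refine ((runLaw_real_eq_prob hH p t K {ω | ε * ∑ k ∈ activeScales p t B,
    (callModel H hH p t).est sel ω k ≤ |∑ k ∈ activeScales p t B,
      (callModel H hH p t).est sel ω k - S|}).le.trans key).trans ?_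
  exact fail_bound_le hC hs hε0 hε1 hK (totalWeight_le p t hH hC hs hcard hS0 hact hSle)

end Main

end

end PatternDistance

theorem mainTheorem1 :
    ∃ a : ℝ, 0 < a ∧
      ∀ (A : Type*) [Fintype A] [MetricSpace A] (B C ε t : ℝ) (m n K : ℕ)
        (H : PatternDistance.ScaleIdx B → PMF (A → ℕ))
        (sel : (PatternDistance.RateIdx m → ℕ) → Option (PatternDistance.RateIdx m))
        (T : Fin n → A) (P : Fin m → A),
        (∀ x y : A, x ≠ y → 1 ≤ dist x y) →
        (∀ x y : A, dist x y ≤ B) →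
        (∀ k, PatternDistance.IsProbSeparating C (PatternDistance.scale k) (H k)) →
        Real.log (Fintype.card A) ≤ Real.exp (C * t) →
        0 < ε → ε ≤ 1 → 1 ≤ t → 3 ≤ m →
        a * (C * t / ε ^ 2) ≤ K →
        PatternDistance.IsRateRule K sel →
        ∀ (i : ℕ) (hi : i + m ≤ n),
          (PatternDistance.exactDist T P i hi ≠ 0 →
            (PatternDistance.runLaw m B K H).real
              {ω | ε * PatternDistance.output sel ω T P i hi ≤
                |PatternDistance.output sel ω T P i hi - PatternDistance.exactDist T P i hi|}
              ≤ Real.exp (-t)) ∧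
          (PatternDistance.exactDist T P i hi = 0 →
            ∀ ω : PatternDistance.Run A m B K, PatternDistance.output sel ω T P i hi = 0) := by
  -- The binding requirement is `K ε² / (4 · 52800²) ≥ t + C t + 38`; the right side is at most `79
  -- C t` because `C t ≥ 1/2` and `t ≤ 2 C t`.
  refine ⟨10 ^ 12, by norm_num, ?_⟩
  intro A _ _ B C ε t m n K H sel T P h1 hB hH hcard hε0 hε1 ht hm hK hsel i hi
  exact ⟨fun hne => PatternDistance.runLaw_fail_le P (PatternDistance.window T i hi) hm h1 hB hH
      hcard hε0 hε1 ht hK hsel hne,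
    fun h0 ω => PatternDistance.sum_scaleEstimate_eq_zero P _ sel h0 ω⟩
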